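/- An $\ell$-group is a group with a lattice order such that $a\le b$ implies $sat\le sbt$; a partially ordered group is defined in the same way with a partial order. A variety of $\ell$-groups is a class of $\ell$-groups defined by identities. Write $\mathrm e$ for the identity element, and let $G$ be a partially ordered group and $\mathsf V$ a variety of $\ell$-groups. A pre-cone of $G$ is a submonoid $C\subsetneq G$ with $G=C\cup C^{-1}$ and $G^+:=\{a\in G\mid a\ge \mathrm e\}\subseteq C$; it is identified with the right pre-order $a\preceq_C b\iff ba^{-1}\in C$. Let $\Omega_C$ be the chain of equivalence classes $[a]$ of the relation "$a\preceq_C b$ and $b\preceq_C a$", ordered by $[a]\le[b]\iff a\preceq_C b$. Its order-preserving permutations form an $\ell$-group $\mathrm{Aut}(\Omega_C)$ (with product $f\cdot g$ = "$g$ after $f$" and point-wise order), and $H_C$ denotes the $\ell$-subgroup (sublattice subgroup) of $\mathrm{Aut}(\Omega_C)$ generated by the maps $[b]\mapsto[ba]$, $a\in G$. Let $\mathcal P_G(\mathsf V)$ be the set of pre-cones $C$ of $G$ with $H_C\in\mathsf V$, with the smallest topology in which all sets $\{C\mid a\in C,\ a^{-1}\notin C\}$, $a\in G$, are open. Its minimal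 layer is the subspace of its inclusion-minimal elements. Let $H=F_{\mathsf V}(G)$ be the $\ell$-group freely generated by $G$ in $\mathsf V$, i.e. the value at $G$ of the left adjoint of the forgetful functor from $\mathsf V$ to partially ordered groups and order-preserving homomorphisms. A prime subgroup of $H$ is an order-convex $\ell$-subgroup $\mathfrak p\ne H$ whose right cosets are totally ordered by $\mathfrak p x\le\mathfrak p y\iff x\le ty$ for some $t\in\mathfrak p$. The set $\mathrm{Spec}\,H$ of prime subgroups carries the topology with open sets $\{\mathfrak p\mid A\not\subseteq\mathfrak p\}$, $A\subseteq H$, and $\mathrm{Min}\,H$ is the subspace of inclusion-minimal prime subgroups. Put $|x|=x\vee x^{-1}$ and $S^\perp=\{x\in H\mid |x|\wedge|y|=\mathrm e\text{ for all }y\in S\}$ for $S\subseteq H$. Let $\mathrm{Pol}\,H$ be the set of polars, that is, of the $T\subseteq H$ with $T=T^{\perp\perp}$; ordered by inclusion it is a Boolean algebra, with complement $T\mapsto T^\perp$. Let $\mathrm{Pol}_{\mathrm p}H=\{\{x\}^{\perp\perp}\mid x\in H\}$. A weak unit of $H$ is an element $w\ge\mathrm e$ such that $w\wedge|x|=\mathrm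 e$ implies $x=\mathrm e$, for all $x\in H$. **Corollary.** For every partially ordered group $G$ and every variety $\mathsf V$ of $\ell$-groups, the minimal layer of $\mathcal P_G(\mathsf V)$ is compact if and only if any one of the following conditions holds for $H=F_{\mathsf V}(G)$; that is, its compactness is equivalent to each of them: 1. $\mathrm{Pol}_{\mathrm p}H$ is a Boolean subalgebra of $\mathrm{Pol}\,H$; 2. $\mathrm{Min}\,H$ is compact; 3. for every $x\in H$ with $x\ge\mathrm e$ there is $y\in H$ with $y\ge\mathrm e$ such that $x\wedge y=\mathrm e$ and $x\vee y$ is a weak unit. -/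

import Mathlib

/-!
Conventions.  A *partially ordered group* is a (multiplicative) group `G` with a partial order
such that multiplication on either side is monotone: `[Group G] [PartialOrder G] [MulLeftMono G]
[MulRightMono G]`.  An *ℓ-group* is the same with a lattice order: `[Group H] [Lattice H]
[MulLeftMono H] [MulRightMono H]`.  The absolute value `x ⊔ x⁻¹` is Mathlib's `|x|ₘ`.
-/

namespace OrderedGroups

universe u v

/-! ### Terms, identities, and varieties of ℓ-groups -/

/-- Terms in the language of ℓ-groups with variables in `X`. -/
inductive LTerm (X : Type u) : Type u
  | var : X → LTerm X
  | one : LTerm X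
  | mul : LTerm X → LTerm X → LTerm X
  | inv : LTerm X → LTerm X
  | sup : LTerm X → LTerm X → LTerm X
  | inf : LTerm X → LTerm X → LTerm X

namespace LTerm

/-- The value of a term under an assignment of the variables. -/
def eval {X : Type u} {H : Type v} [Group H] [Lattice H] (f : X → H) : LTerm X → H
  | var x => f x
  | one => 1
  | mul s t => eval f s * eval f t
  | inv s => (eval f s)⁻¹
  | sup s t => eval f s ⊔ eval f t
  | inf s t => eval f s ⊓ eval f t

/-- Simultaneous substitution of terms for variables. -/
def subst {X : Type u} {Y : Type v} (f : X → LTerm Y) : LTerm X → LTerm Y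
  | var x => f x
  | one => one
  | mul s t => mul (subst f s) (subst f t)
  | inv s => inv (subst f s)
  | sup s t => sup (subst f s) (subst f t)
  | inf s t => inf (subst f s) (subst f t)

theorem eval_subst {X : Type*} {Y : Type*} {H : Type*} [Group H] [Lattice H]
    (f : X → LTerm Y) (g : Y → H) (t : LTerm X) :
    (t.subst f).eval g = t.eval (fun x => (f x).eval g) := by
  induction t <;> simp_all [subst, eval]

end LTerm

/-- A variety (equationally definable class) of ℓ-groups, presented by a set of identities
`s ≈ t` in countably many variables. -/
structure LVariety where
  identities : Set (LTerm ℕ × LTerm ℕ)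

/-- The ℓ-group `H` belongs to the variety `V`: it satisfies all identities of `V`. -/
def LVariety.Mem (V : LVariety) (H : Type v) [Group H] [Lattice H] : Prop :=
  ∀ e ∈ V.identities, ∀ f : ℕ → H, e.1.eval f = e.2.eval f

/-! ### The free ℓ-group over a partially ordered group in a variety -/

section Free

variable (V : LVariety) (G : Type u) [Group G] [PartialOrder G]

/-- The congruence on terms over `G` generated by the axioms of ℓ-groups, the identities of `V`,
and the relations which make the inclusion of `G` a positive group homomorphism. -/
inductive FreeRel : LTerm G → LTerm G → Prop
  | refl (x) : FreeRel x x
  | symm {x y} : FreeRel x y → FreeRel y x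
  | trans {x y z} : FreeRel x y → FreeRel y z → FreeRel x z
  | mul_congr {x x' y y'} : FreeRel x x' → FreeRel y y' → FreeRel (.mul x y) (.mul x' y')
  | inv_congr {x x'} : FreeRel x x' → FreeRel (.inv x) (.inv x')
  | sup_congr {x x' y y'} : FreeRel x x' → FreeRel y y' → FreeRel (.sup x y) (.sup x' y')
  | inf_congr {x x' y y'} : FreeRel x x' → FreeRel y y' → FreeRel (.inf x y) (.inf x' y')
  | mul_assoc (x y z) : FreeRel (.mul (.mul x y) z) (.mul x (.mul y z))
  | one_mul (x) : FreeRel (.mul .one x) x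
  | inv_mul (x) : FreeRel (.mul (.inv x) x) .one
  | sup_comm (x y) : FreeRel (.sup x y) (.sup y x)
  | sup_assoc (x y z) : FreeRel (.sup (.sup x y) z) (.sup x (.sup y z))
  | inf_comm (x y) : FreeRel (.inf x y) (.inf y x)
  | inf_assoc (x y z) : FreeRel (.inf (.inf x y) z) (.inf x (.inf y z))
  | sup_inf_self (x y) : FreeRel (.sup x (.inf x y)) x
  | inf_sup_self (x y) : FreeRel (.inf x (.sup x y)) x
  | mul_sup (x y z) : FreeRel (.mul x (.sup y z)) (.sup (.mul x y) (.mul x z))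
  | sup_mul (x y z) : FreeRel (.mul (.sup x y) z) (.sup (.mul x z) (.mul y z))
  | identity (e : LTerm ℕ × LTerm ℕ) (he : e ∈ V.identities) (f : ℕ → LTerm G) :
      FreeRel (e.1.subst f) (e.2.subst f)
  | gen_mul (a b : G) : FreeRel (.var (a * b)) (.mul (.var a) (.var b))
  | gen_le (a b : G) (hab : a ≤ b) : FreeRel (.sup (.var a) (.var b)) (.var b)

/-- `FreeRel` as a setoid. -/
def freeSetoid : Setoid (LTerm G) where
  r := FreeRel V G
  iseqv := ⟨.refl, .symm, .trans⟩

/-- The ℓ-group freely generated by the partially ordered group `G` in the variety `V`. -/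
def FreeLGroup : Type u := Quotient (freeSetoid V G)

namespace FreeLGroup

variable {V G}

/-- The class of a term. -/
def mk (t : LTerm G) : FreeLGroup V G := Quotient.mk (freeSetoid V G) t

theorem sound {s t : LTerm G} (h : FreeRel V G s t) : (mk s : FreeLGroup V G) = mk t :=
  Quotient.sound (s := freeSetoid V G) h

theorem mk_surjective (x : FreeLGroup V G) : ∃ t, mk t = x :=
  Quotient.exists_rep x

instance : Mul (FreeLGroup V G) :=
  ⟨Quotient.map₂ (sa := freeSetoid V G) (sb := freeSetoid V G) (sc := freeSetoid V G)
    LTerm.mul (fun _ _ h _ _ h' => FreeRel.mul_congr h h')⟩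

instance : Inv (FreeLGroup V G) :=
  ⟨Quotient.map (sa := freeSetoid V G) (sb := freeSetoid V G)
    LTerm.inv (fun _ _ h => FreeRel.inv_congr h)⟩

instance : One (FreeLGroup V G) := ⟨mk LTerm.one⟩

instance : Max (FreeLGroup V G) :=
  ⟨Quotient.map₂ (sa := freeSetoid V G) (sb := freeSetoid V G) (sc := freeSetoid V G)
    LTerm.sup (fun _ _ h _ _ h' => FreeRel.sup_congr h h')⟩

instance : Min (FreeLGroup V G) :=
  ⟨Quotient.map₂ (sa := freeSetoid V G) (sb := freeSetoid V G) (sc := freeSetoid V G)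
    LTerm.inf (fun _ _ h _ _ h' => FreeRel.inf_congr h h')⟩

instance : Group (FreeLGroup V G) :=
  Group.ofLeftAxioms
    (by rintro ⟨x⟩ ⟨y⟩ ⟨z⟩; exact sound (.mul_assoc x y z))
    (by rintro ⟨x⟩; exact sound (.one_mul x))
    (by rintro ⟨x⟩; exact sound (.inv_mul x))

/-- The lattice order is `x ≤ y ↔ x ⊔ y = y`. -/
instance : Lattice (FreeLGroup V G) :=
  Lattice.mk'
    (by rintro ⟨x⟩ ⟨y⟩; exact sound (.sup_comm x y))
    (by rintro ⟨x⟩ ⟨y⟩ ⟨z⟩; exact sound (.sup_assoc x y z))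
    (by rintro ⟨x⟩ ⟨y⟩; exact sound (.inf_comm x y))
    (by rintro ⟨x⟩ ⟨y⟩ ⟨z⟩; exact sound (.inf_assoc x y z))
    (by rintro ⟨x⟩ ⟨y⟩; exact sound (.sup_inf_self x y))
    (by rintro ⟨x⟩ ⟨y⟩; exact sound (.inf_sup_self x y))

theorem mul_sup' (x y z : FreeLGroup V G) : x * (y ⊔ z) = x * y ⊔ x * z := by
  revert x y z
  rintro ⟨x⟩ ⟨y⟩ ⟨z⟩
  exact sound (.mul_sup x y z)

theorem sup_mul' (x y z : FreeLGroup V G) : (x ⊔ y) * z = x * z ⊔ y * z := by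
  revert x y z
  rintro ⟨x⟩ ⟨y⟩ ⟨z⟩
  exact sound (.sup_mul x y z)

instance : MulLeftMono (FreeLGroup V G) := ⟨fun x y z h =>
  sup_eq_right.1 ((mul_sup' x y z).symm.trans (congrArg (x * ·) (sup_eq_right.2 h)))⟩

instance : MulRightMono (FreeLGroup V G) := ⟨fun x y z h =>
  sup_eq_right.1 ((sup_mul' y z x).symm.trans (congrArg (· * x) (sup_eq_right.2 h)))⟩

/-- The universal map `η : G → F_V(G)`. -/
def eta : G →* FreeLGroup V G :=
  MonoidHom.mk' (fun a => mk (.var a)) (fun a b => sound (.gen_mul a b))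

theorem eta_monotone : Monotone (eta : G →* FreeLGroup V G) := fun a b hab =>
  sup_eq_right.1 (sound (.gen_le a b hab))

theorem eval_mk {X : Type*} (f : X → LTerm G) (t : LTerm X) :
    t.eval (fun x => (mk (f x) : FreeLGroup V G)) = mk (t.subst f) := by
  induction t with
  | var x => rfl
  | one => rfl
  | mul s t hs ht => rw [LTerm.eval, hs, ht]; rfl
  | inv s hs => rw [LTerm.eval, hs]; rfl
  | sup s t hs ht => rw [LTerm.eval, hs, ht]; rfl
  | inf s t hs ht => rw [LTerm.eval, hs, ht]; rfl

variable (V G) in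
/-- The free ℓ-group in `V` is a member of `V`. -/
theorem mem_variety : V.Mem (FreeLGroup V G) := by
  intro e he f
  choose g hg using fun n => mk_surjective (f n)
  obtain rfl : (fun n => mk (g n)) = f := funext hg
  rw [eval_mk, eval_mk]
  exact sound (.identity e he g)

theorem eval_eq_of_rel {H : Type v} [Group H] [Lattice H] [MulLeftMono H] [MulRightMono H]
    (hH : V.Mem H) (p : G →* H) (hp : Monotone p) {s t : LTerm G} (h : FreeRel V G s t) :
    s.eval p = t.eval p := by
  induction h with
  | refl => rfl
  | symm _ ih => exact ih.symm
  | trans _ _ ih ih' => exact ih.trans ih'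
  | mul_congr _ _ ih ih' => simp only [LTerm.eval, ih, ih']
  | inv_congr _ ih => simp only [LTerm.eval, ih]
  | sup_congr _ _ ih ih' => simp only [LTerm.eval, ih, ih']
  | inf_congr _ _ ih ih' => simp only [LTerm.eval, ih, ih']
  | mul_assoc => exact _root_.mul_assoc _ _ _
  | one_mul => exact _root_.one_mul _
  | inv_mul => exact inv_mul_cancel _
  | sup_comm => exact _root_.sup_comm _ _
  | sup_assoc => exact _root_.sup_assoc _ _ _
  | inf_comm => exact _root_.inf_comm _ _
  | inf_assoc => exact _root_.inf_assoc _ _ _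
  | sup_inf_self => exact _root_.sup_inf_self
  | inf_sup_self => exact _root_.inf_sup_self
  | mul_sup => exact _root_.mul_sup _ _ _
  | sup_mul => exact _root_.sup_mul _ _ _
  | identity e he f => rw [LTerm.eval_subst, LTerm.eval_subst]; exact hH e he _
  | gen_mul a b => exact map_mul p a b
  | gen_le a b hab => exact sup_eq_right.2 (hp hab)

/-- The universal property of `η : G → F_V(G)`. -/
theorem existsUnique_lift {H : Type v} [Group H] [Lattice H] [MulLeftMono H] [MulRightMono H]
    (hH : V.Mem H) (p : G →* H) (hp : Monotone p) :
    ∃! h : FreeLGroup V G →* H, (∀ x y, h (x ⊔ y) = h x ⊔ h y) ∧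
      (∀ x y, h (x ⊓ y) = h x ⊓ h y) ∧ ∀ a, h (eta a) = p a := by
  let φ : FreeLGroup V G → H :=
    Quotient.lift (s := freeSetoid V G) (fun t => t.eval p) (fun _ _ h => eval_eq_of_rel hH p hp h)
  refine ⟨MonoidHom.mk' φ (by rintro ⟨x⟩ ⟨y⟩; rfl), ⟨?_, ?_, fun a => rfl⟩, ?_⟩
  · rintro ⟨x⟩ ⟨y⟩; rfl
  · rintro ⟨x⟩ ⟨y⟩; rfl
  · rintro h ⟨hs, hi, ha⟩
    ext x
    obtain ⟨t, rfl⟩ := mk_surjective x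
    change h (mk t) = t.eval p
    induction t with
    | var a => exact ha a
    | one => exact map_one h
    | mul s t ihs iht => rw [LTerm.eval, ← ihs, ← iht, ← map_mul]; rfl
    | inv s ihs => rw [LTerm.eval, ← ihs, ← map_inv]; rfl
    | sup s t ihs iht => rw [LTerm.eval, ← ihs, ← iht, ← hs]; rfl
    | inf s t ihs iht => rw [LTerm.eval, ← ihs, ← iht, ← hi]; rfl

end FreeLGroup

end Free

/-! ### ℓ-subgroups -/

/-- An ℓ-subgroup: a subgroup which is also a sublattice. -/
structure LSubgroup (H : Type u) [Group H] [Lattice H] extends Subgroup H, Sublattice H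

namespace LSubgroup

variable {H : Type u} [Group H] [Lattice H]

instance : SetLike (LSubgroup H) H where
  coe K := K.carrier
  coe_injective := by
    rintro ⟨⟨⟨⟨_, _⟩, _⟩, _⟩, _, _⟩ ⟨⟨⟨⟨_, _⟩, _⟩, _⟩, _, _⟩ h
    cases h
    rfl

instance : SubgroupClass (LSubgroup H) H where
  mul_mem {K} := K.mul_mem'
  one_mem K := K.one_mem'
  inv_mem {K} := K.inv_mem'

/-- An ℓ-subgroup is a lattice under the induced order, with the lattice operations of `H`. -/
instance (K : LSubgroup H) : Lattice K :=
  Subtype.lattice (fun _ _ hx hy => K.supClosed' hx hy) (fun _ _ hx hy => K.infClosed' hx hy)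

/-- The ℓ-subgroup generated by a set: the intersection of all ℓ-subgroups containing it. -/
def closure (S : Set H) : LSubgroup H where
  carrier := {x | ∀ K : LSubgroup H, S ⊆ (K : Set H) → x ∈ K}
  mul_mem' hx hy K hK := mul_mem (hx K hK) (hy K hK)
  one_mem' K _ := one_mem K
  inv_mem' hx K hK := inv_mem (hx K hK)
  supClosed' _ hx _ hy K hK := K.supClosed' (hx K hK) (hy K hK)
  infClosed' _ hx _ hy K hK := K.infClosed' (hx K hK) (hy K hK)

end LSubgroup

/-! ### The ℓ-group of automorphisms of a chain -/

/-- The order-preserving permutations of a chain `Ω`. -/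
def ChainAut (Ω : Type u) [LinearOrder Ω] : Type u := Ω ≃o Ω

namespace ChainAut

variable {Ω : Type u} [LinearOrder Ω]

instance : FunLike (ChainAut Ω) Ω Ω := inferInstanceAs (FunLike (Ω ≃o Ω) Ω Ω)

/-- The product `f * g` is `g` after `f`. -/
instance : Group (ChainAut Ω) where
  mul f g := OrderIso.trans f g
  one := OrderIso.refl Ω
  inv f := OrderIso.symm f
  mul_assoc _ _ _ := rfl
  one_mul _ := rfl
  mul_one _ := rfl
  inv_mul_cancel f := OrderIso.symm_trans_self f

/-- The order is point-wise. -/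
instance : PartialOrder (ChainAut Ω) :=
  PartialOrder.lift (fun f : ChainAut Ω => (f : Ω → Ω)) DFunLike.coe_injective

/-- The point-wise maximum of two order automorphisms. -/
def sup (f g : ChainAut Ω) : ChainAut Ω :=
  StrictMono.orderIsoOfRightInverse (fun x => f x ⊔ g x)
    (fun _ _ h => max_lt_max (OrderIso.strictMono f h) (OrderIso.strictMono g h))
    (fun x => OrderIso.symm f x ⊓ OrderIso.symm g x)
    (fun x => by
      apply le_antisymm
      · refine sup_le ?_ ?_
        · exact ((OrderIso.monotone f) inf_le_left).trans_eq (OrderIso.apply_symm_apply f x)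
        · exact ((OrderIso.monotone g) inf_le_right).trans_eq (OrderIso.apply_symm_apply g x)
      · rcases le_total (OrderIso.symm f x) (OrderIso.symm g x) with h | h
        · simp only [inf_eq_left.2 h]
          exact le_sup_of_le_left (OrderIso.apply_symm_apply f x).ge
        · simp only [inf_eq_right.2 h]
          exact le_sup_of_le_right (OrderIso.apply_symm_apply g x).ge)

/-- The point-wise minimum of two order automorphisms. -/
def inf (f g : ChainAut Ω) : ChainAut Ω :=
  StrictMono.orderIsoOfRightInverse (fun x => f x ⊓ g x)
    (fun _ _ h => min_lt_min (OrderIso.strictMono f h) (OrderIso.strictMono g h))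
    (fun x => OrderIso.symm f x ⊔ OrderIso.symm g x)
    (fun x => by
      apply le_antisymm
      · rcases le_total (OrderIso.symm f x) (OrderIso.symm g x) with h | h
        · simp only [sup_eq_right.2 h]
          exact inf_le_of_right_le (OrderIso.apply_symm_apply g x).le
        · simp only [sup_eq_left.2 h]
          exact inf_le_of_left_le (OrderIso.apply_symm_apply f x).le
      · refine le_inf ?_ ?_
        · exact (OrderIso.apply_symm_apply f x).symm.trans_le ((OrderIso.monotone f) le_sup_left)
        · exact (OrderIso.apply_symm_apply g x).symm.trans_le ((OrderIso.monotone g) le_sup_right))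

instance : Lattice (ChainAut Ω) where
  sup := sup
  inf := inf
  le_sup_left f g x := le_sup_left (a := f x) (b := g x)
  le_sup_right f g x := le_sup_right (a := f x) (b := g x)
  sup_le _ _ _ h h' x := sup_le (h x) (h' x)
  inf_le_left f g x := inf_le_left (a := f x) (b := g x)
  inf_le_right f g x := inf_le_right (a := f x) (b := g x)
  le_inf _ _ _ h h' x := le_inf (h x) (h' x)

instance : MulLeftMono (ChainAut Ω) := ⟨fun f _ _ h x => h (f x)⟩

instance : MulRightMono (ChainAut Ω) := ⟨fun f _ _ h x => OrderIso.monotone f (h x)⟩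

end ChainAut

/-! ### Right pre-orders and the right regular representation -/

/-- A pre-cone of a partially ordered group `G`: a proper submonoid `C` with `G = C ∪ C⁻¹` and
`G⁺ ⊆ C`.  It is identified with the right pre-order `a ≼ b ↔ b * a⁻¹ ∈ C`. -/
structure PreCone (G : Type u) [Group G] [PartialOrder G] extends Submonoid G where
  total' : ∀ a : G, a ∈ carrier ∨ a⁻¹ ∈ carrier
  pos' : ∀ a : G, 1 ≤ a → a ∈ carrier
  proper' : carrier ≠ Set.univ

namespace PreCone

variable {G : Type u} [Group G] [PartialOrder G]

instance : SetLike (PreCone G) G where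
  coe C := C.carrier
  coe_injective := by
    rintro ⟨⟨⟨_, _⟩, _⟩, _, _, _⟩ ⟨⟨⟨_, _⟩, _⟩, _, _, _⟩ h
    cases h
    rfl

instance : SubmonoidClass (PreCone G) G where
  mul_mem {C} := C.mul_mem'
  one_mem C := C.one_mem'

/-- Pre-cones are ordered by inclusion. -/
instance : PartialOrder (PreCone G) := PartialOrder.ofSetLike (PreCone G) G

/-- The right pre-order associated with a pre-cone. -/
def Le (C : PreCone G) (a b : G) : Prop := b * a⁻¹ ∈ C

variable (C : PreCone G)

theorem le_refl (a : G) : C.Le a a := by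
  simp [Le]

variable {C} in
theorem Le.trans {a b c : G} (h : C.Le a b) (h' : C.Le b c) : C.Le a c := by
  simpa [Le] using mul_mem h' h

theorem le_total (a b : G) : C.Le a b ∨ C.Le b a := by
  have h := C.total' (b * a⁻¹)
  rwa [mul_inv_rev, inv_inv] at h

theorem mul_right_le_iff {a b : G} (t : G) : C.Le (a * t) (b * t) ↔ C.Le a b := by
  simp [Le, _root_.mul_assoc]

/-- The equivalence relation `a ≡ b ↔ a ≼ b ∧ b ≼ a`. -/
def setoid : Setoid G where
  r a b := C.Le a b ∧ C.Le b a
  iseqv := ⟨fun a => ⟨C.le_refl a, C.le_refl a⟩, fun h => ⟨h.2, h.1⟩,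
    fun h h' => ⟨h.1.trans h'.1, h'.2.trans h.2⟩⟩

/-- The chain `Ω_C` of equivalence classes. -/
def Omega : Type u := Quotient C.setoid

/-- The class `[a]` of `a`. -/
def cls (a : G) : C.Omega := Quotient.mk C.setoid a

/-- `Ω_C` is totally ordered by `[a] ≤ [b] ↔ a ≼ b`. -/
noncomputable instance : LinearOrder C.Omega where
  le := Quotient.lift₂ (s₁ := C.setoid) (s₂ := C.setoid) C.Le (fun _ _ _ _ h h' =>
    propext ⟨fun k => (h.2.trans k).trans h'.1, fun k => (h.1.trans k).trans h'.2⟩)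
  le_refl := by rintro ⟨a⟩; exact C.le_refl a
  le_trans := by rintro ⟨a⟩ ⟨b⟩ ⟨c⟩ h h'; exact Le.trans h h'
  le_antisymm := by rintro ⟨a⟩ ⟨b⟩ h h'; exact Quotient.sound (s := C.setoid) ⟨h, h'⟩
  le_total := by rintro ⟨a⟩ ⟨b⟩; exact C.le_total a b
  toDecidableLE := Classical.decRel _

theorem cls_le_cls {a b : G} : C.cls a ≤ C.cls b ↔ C.Le a b := Iff.rfl

/-- Right translation `[b] ↦ [b * a]` as a map on `Ω_C`. -/
def translate (a : G) : C.Omega → C.Omega :=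
  Quotient.map (sa := C.setoid) (sb := C.setoid) (fun b => b * a)
    (fun _ _ h => ⟨(C.mul_right_le_iff a).2 h.1, (C.mul_right_le_iff a).2 h.2⟩)

/-- The right regular representation `ρ_C(a) : [b] ↦ [b * a]`. -/
noncomputable def rho : G →* ChainAut C.Omega :=
  MonoidHom.mk'
    (fun a =>
      { toFun := C.translate a
        invFun := C.translate a⁻¹
        left_inv := by
          rintro ⟨b⟩
          exact congrArg C.cls (mul_inv_cancel_right b a)
        right_inv := by
          rintro ⟨b⟩
          exact congrArg C.cls (inv_mul_cancel_right b a)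
        map_rel_iff' := by
          rintro ⟨b⟩ ⟨c⟩
          exact C.mul_right_le_iff a } : G → (C.Omega ≃o C.Omega))
    (fun a b => by
      refine DFunLike.ext (F := C.Omega ≃o C.Omega) _ _ ?_
      rintro ⟨c⟩
      exact congrArg C.cls (_root_.mul_assoc c a b).symm)

theorem rho_apply (a b : G) : C.rho a (C.cls b) = C.cls (b * a) := rfl

/-- `H_C`: the ℓ-subgroup of `Aut(Ω_C)` generated by the image of the regular representation. -/
noncomputable def H : LSubgroup (ChainAut C.Omega) := LSubgroup.closure (Set.range C.rho)

end PreCone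

/-- The set of right pre-orders of the variety `V` on `G`: the pre-cones `C` with `H_C ∈ V`. -/
def VPreorders (V : LVariety) (G : Type u) [Group G] [PartialOrder G] : Type u :=
  {C : PreCone G // V.Mem C.H}

namespace VPreorders

variable {V : LVariety} {G : Type u} [Group G] [PartialOrder G]

/-- The set `ℙ(a)` of those `C` with `a ∈ C` and `a⁻¹ ∉ C`. -/
def basicOpen (a : G) : Set (VPreorders V G) := {C | a ∈ C.1 ∧ a⁻¹ ∉ C.1}

/-- The smallest topology containing all the sets `ℙ(a)`. -/
instance : TopologicalSpace (VPreorders V G) :=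
  TopologicalSpace.generateFrom (Set.range basicOpen)

/-- The inclusion order. -/
instance : PartialOrder (VPreorders V G) :=
  inferInstanceAs (PartialOrder {C : PreCone G // V.Mem C.H})

variable (V G) in
/-- The minimal layer: the subspace of inclusion-minimal elements. -/
def minimalLayer : Set (VPreorders V G) := {C | IsMin C}

end VPreorders

/-! ### Prime subgroups and the spectral topology -/

/-- A prime (convex ℓ-)subgroup `p` of an ℓ-group `H`: an order-convex ℓ-subgroup which is proper
and such that the right cosets are totally ordered by `p x ≤ p y ↔ ∃ t ∈ p, x ≤ t * y`. -/
structure PrimeSubgroup (H : Type u) [Group H] [Lattice H] extends LSubgroup H where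
  ordConnected' : carrier.OrdConnected
  proper' : carrier ≠ Set.univ
  total' : ∀ x y : H, (∃ t ∈ carrier, x ≤ t * y) ∨ (∃ t ∈ carrier, y ≤ t * x)

namespace PrimeSubgroup

variable {H : Type u} [Group H] [Lattice H]

instance : SetLike (PrimeSubgroup H) H where
  coe p := p.carrier
  coe_injective := by
    rintro ⟨⟨⟨⟨⟨_, _⟩, _⟩, _⟩, _, _⟩, _, _, _⟩ ⟨⟨⟨⟨⟨_, _⟩, _⟩, _⟩, _, _⟩, _, _, _⟩ h
    cases h
    rfl

instance : SubgroupClass (PrimeSubgroup H) H where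
  mul_mem {p} := p.mul_mem'
  one_mem p := p.one_mem'
  inv_mem {p} := p.inv_mem'

/-- Prime subgroups are ordered by inclusion. -/
instance : PartialOrder (PrimeSubgroup H) := PartialOrder.ofSetLike (PrimeSubgroup H) H

/-- The set `𝕊(A)` of the prime subgroups which do not contain `A`. -/
def support (A : Set H) : Set (PrimeSubgroup H) := {p | ¬ A ⊆ (p : Set H)}

variable [MulLeftMono H] [MulRightMono H]

theorem mabs_mem_iff (p : PrimeSubgroup H) {a : H} : |a|ₘ ∈ p ↔ a ∈ p :=
  ⟨fun h => p.ordConnected'.out (inv_mem h) h ⟨inv_le'.1 (inv_le_mabs a), le_mabs_self a⟩,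
    fun h => p.supClosed' h (inv_mem h)⟩

theorem mabs_inf_mabs_mem_iff (p : PrimeSubgroup H) {a b : H} :
    |a|ₘ ⊓ |b|ₘ ∈ p ↔ a ∈ p ∨ b ∈ p := by
  have key : ∀ a b t : H, t ∈ p → |a|ₘ ≤ t * |b|ₘ → |a|ₘ ⊓ |b|ₘ ∈ p → a ∈ p := by
    intro a b t ht hab h
    refine p.mabs_mem_iff.1 (p.ordConnected'.out (one_mem p)
      (mul_mem (p.mabs_mem_iff.2 ht) h) ⟨one_le_mabs a, ?_⟩)
    rw [mul_inf]
    exact le_inf (le_mul_of_one_le_left' (one_le_mabs t))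
      (hab.trans (mul_le_mul_left (le_mabs_self t) _))
  constructor
  · intro h
    rcases p.total' |a|ₘ |b|ₘ with ⟨t, ht, hab⟩ | ⟨t, ht, hab⟩
    · exact Or.inl (key a b t ht hab h)
    · exact Or.inr (key b a t ht hab (by rwa [inf_comm]))
  · have h1 : (1 : H) ≤ |a|ₘ ⊓ |b|ₘ := le_inf (one_le_mabs a) (one_le_mabs b)
    rintro (h | h)
    · exact p.ordConnected'.out (one_mem p) (p.mabs_mem_iff.2 h) ⟨h1, inf_le_left⟩
    · exact p.ordConnected'.out (one_mem p) (p.mabs_mem_iff.2 h) ⟨h1, inf_le_right⟩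

/-- The spectral (Zariski) topology: the open sets are the sets `𝕊(A)`, for `A ⊆ H`. -/
instance : TopologicalSpace (PrimeSubgroup H) where
  IsOpen U := ∃ A : Set H, U = support A
  isOpen_univ := ⟨Set.univ, by
    ext p
    exact iff_of_true trivial (fun h => p.proper' (Set.univ_subset_iff.1 h))⟩
  isOpen_inter := by
    rintro _ _ ⟨A, rfl⟩ ⟨B, rfl⟩
    refine ⟨Set.image2 (fun a b => |a|ₘ ⊓ |b|ₘ) A B, ?_⟩
    ext p
    constructor
    · rintro ⟨hA, hB⟩ h
      obtain ⟨a, ha, ha'⟩ := Set.not_subset.1 hA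
      obtain ⟨b, hb, hb'⟩ := Set.not_subset.1 hB
      rcases p.mabs_inf_mabs_mem_iff.1 (h ⟨a, ha, b, hb, rfl⟩) with h | h
      · exact ha' h
      · exact hb' h
    · refine fun h => ⟨fun hA => h ?_, fun hB => h ?_⟩
      · rintro _ ⟨a, ha, b, hb, rfl⟩
        exact p.mabs_inf_mabs_mem_iff.2 (Or.inl (hA ha))
      · rintro _ ⟨a, ha, b, hb, rfl⟩
        exact p.mabs_inf_mabs_mem_iff.2 (Or.inr (hB hb))
  isOpen_sUnion := by
    intro S hS
    refine ⟨⋃₀ {A | support A ∈ S}, ?_⟩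
    ext p
    constructor
    · rintro ⟨U, hU, hp⟩ h
      obtain ⟨A, rfl⟩ := hS U hU
      exact hp ((Set.subset_sUnion_of_mem (show A ∈ {A | support A ∈ S} from hU)).trans h)
    · intro h
      by_contra hn
      exact h (Set.sUnion_subset fun A hA => by_contra fun hp => hn ⟨_, hA, hp⟩)

end PrimeSubgroup

/-- The minimal spectrum of `H`: the subspace of inclusion-minimal prime subgroups. -/
def minimalSpectrum (H : Type u) [Group H] [Lattice H] : Set (PrimeSubgroup H) := {p | IsMin p}

/-! ### Polars -/

section Polars

variable {H : Type u} [Group H] [Lattice H]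

/-- `S^⊥`: the set of elements orthogonal to every element of `S`. -/
def perp (S : Set H) : Set H := {x | ∀ y ∈ S, |x|ₘ ⊓ |y|ₘ = 1}

theorem perp_anti {S T : Set H} (h : S ⊆ T) : perp T ⊆ perp S := fun _ hx y hy => hx y (h hy)

theorem subset_perp_perp (S : Set H) : S ⊆ perp (perp S) := fun x hx y hy => by
  rw [inf_comm]; exact hy x hx

theorem perp_perp_perp (S : Set H) : perp (perp (perp S)) = perp S :=
  (perp_anti (subset_perp_perp S)).antisymm (subset_perp_perp _)

variable (H) in
/-- The set `Pol(H)` of polars of `H`: the subsets `T` with `T = T^⊥⊥`. -/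
def Polar : Type u := {T : Set H // perp (perp T) = T}

namespace Polar

/-- Polars are ordered by inclusion. -/
instance : PartialOrder (Polar H) :=
  inferInstanceAs (PartialOrder {T : Set H // perp (perp T) = T})

variable [MulLeftMono H] [MulRightMono H]

theorem mem_perp_of_mabs_le {S : Set H} {x y : H} (hy : y ∈ perp S) (h : |x|ₘ ≤ |y|ₘ) :
    x ∈ perp S := fun z hz =>
  le_antisymm ((inf_le_inf_right _ h).trans_eq (hy z hz)) (le_inf (one_le_mabs x) (one_le_mabs z))

theorem one_mem_perp (S : Set H) : (1 : H) ∈ perp S := fun z _ => by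
  rw [mabs_one]; exact inf_eq_left.2 (one_le_mabs z)

theorem eq_one_of_mem {S : Set H} {x : H} (h : x ∈ S) (h' : x ∈ perp S) : x = 1 := by
  have := h' x h
  rw [inf_idem] at this
  exact le_antisymm (this ▸ le_mabs_self x) (inv_le_one'.1 (this ▸ inv_le_mabs x))

theorem mabs_inf_mabs (x y : H) : |(|x|ₘ ⊓ |y|ₘ)|ₘ = |x|ₘ ⊓ |y|ₘ :=
  mabs_of_one_le (le_inf (one_le_mabs x) (one_le_mabs y))

theorem mem_of_mabs_le (T : Polar H) {x y : H} (hy : y ∈ T.1) (h : |x|ₘ ≤ |y|ₘ) : x ∈ T.1 := by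
  rw [← T.2] at hy ⊢
  exact mem_perp_of_mabs_le hy h

theorem perp_union_inf {A B C : Polar H} {x : H} (hA : x ∈ A.1)
    (hBC : x ∈ perp (perp (B.1 ∪ C.1))) :
    x ∈ perp (perp ((A.1 ∩ B.1) ∪ (A.1 ∩ C.1))) := by
  intro y hy
  set z := |x|ₘ ⊓ |y|ₘ with hz
  have hzz : |z|ₘ = z := mabs_inf_mabs x y
  have hzx : |z|ₘ ≤ |x|ₘ := hzz.trans_le inf_le_left
  have hzy : |z|ₘ ≤ |y|ₘ := hzz.trans_le inf_le_right
  refine eq_one_of_mem (S := perp (B.1 ∪ C.1)) ?_ (mem_perp_of_mabs_le hBC hzx)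
  have aux : ∀ D : Polar H, (A.1 ∩ D.1 ⊆ (A.1 ∩ B.1) ∪ (A.1 ∩ C.1)) → ∀ d ∈ D.1,
      |z|ₘ ⊓ |d|ₘ = 1 := by
    intro D hD d hd
    set w := |z|ₘ ⊓ |d|ₘ with hw
    have hww : |w|ₘ = w := mabs_inf_mabs z d
    have hwA : w ∈ A.1 := A.mem_of_mabs_le hA ((hww.trans_le inf_le_left).trans hzx)
    have hwD : w ∈ D.1 := D.mem_of_mabs_le hd (hww.trans_le inf_le_right)
    have := hy w (hD ⟨hwA, hwD⟩)
    rwa [inf_eq_right.2 ((hww.trans_le inf_le_left).trans hzy), hww] at this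
  rintro d (hd | hd)
  · exact aux B Set.subset_union_left d hd
  · exact aux C Set.subset_union_right d hd

/-- Under inclusion `Pol(H)` is a lattice, with intersections as meets and `(S ∪ T)^⊥⊥` as
joins. -/
instance : Lattice (Polar H) where
  sup S T := ⟨perp (perp (S.1 ∪ T.1)), perp_perp_perp _⟩
  inf S T := ⟨S.1 ∩ T.1, (Set.subset_inter
    ((perp_anti (perp_anti Set.inter_subset_left)).trans S.2.subset)
    ((perp_anti (perp_anti Set.inter_subset_right)).trans T.2.subset)).antisymm
      (subset_perp_perp _)⟩
  le_sup_left S T := Set.subset_union_left.trans (subset_perp_perp (S.1 ∪ T.1))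
  le_sup_right S T := Set.subset_union_right.trans (subset_perp_perp (S.1 ∪ T.1))
  sup_le S T R h h' := (perp_anti (perp_anti (Set.union_subset h h'))).trans R.2.subset
  inf_le_left S T := Set.inter_subset_left (s := S.1) (t := T.1)
  inf_le_right S T := Set.inter_subset_right (s := S.1) (t := T.1)
  le_inf S T R h h' := Set.subset_inter (r := S.1) (s := T.1) (t := R.1) h h'

instance : DistribLattice (Polar H) :=
  DistribLattice.ofInfSupLe (fun A B C x (hx : x ∈ A.1 ∩ perp (perp (B.1 ∪ C.1))) =>
    perp_union_inf (A := A) (B := B) (C := C) hx.1 hx.2)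

/-- `Pol(H)` is a Boolean algebra, with maximum `H`, minimum `{e}`, and complement `T ↦ T^⊥`. -/
instance : BooleanAlgebra (Polar H) where
  top := ⟨Set.univ, Set.eq_univ_of_univ_subset (subset_perp_perp _)⟩
  bot := ⟨{1}, by
    refine Set.Subset.antisymm (fun x hx => ?_) (subset_perp_perp _)
    refine eq_one_of_mem (S := perp {1}) (fun y hy => ?_) hx
    rw [Set.mem_singleton_iff.1 hy, mabs_one]
    exact inf_eq_right.2 (one_le_mabs x)⟩
  compl T := ⟨perp T.1, perp_perp_perp _⟩
  le_top T := Set.subset_univ T.1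
  bot_le T := Set.singleton_subset_iff.2 (T.2 ▸ one_mem_perp (perp T.1))
  inf_compl_le_bot T := fun x (hx : x ∈ T.1 ∩ perp T.1) => Set.mem_singleton_iff.2 (eq_one_of_mem hx.1 hx.2)
  top_le_sup_compl T := fun x _ y hy => by
    have hy1 : y = 1 := eq_one_of_mem (S := perp T.1)
      (perp_anti Set.subset_union_left hy) (perp_anti Set.subset_union_right hy)
    rw [hy1, mabs_one]
    exact inf_eq_right.2 (one_le_mabs x)

end Polar

/-- The principal polar `x^⊥⊥`. -/
def principalPolar (x : H) : Polar H := ⟨perp (perp {x}), perp_perp_perp _⟩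

variable (H) in
/-- The set `Pol_p(H)` of principal polars. -/
def principalPolars : Set (Polar H) := Set.range principalPolar

variable (H) in
/-- `Pol_p(H)` is a Boolean subalgebra of `Pol(H)`. -/
def PrincipalPolarsBoolean [MulLeftMono H] [MulRightMono H] : Prop :=
  ∃ B : BooleanSubalgebra (Polar H), (B : Set (Polar H)) = principalPolars H

/-- A weak (order) unit. -/
def IsWeakUnit (w : H) : Prop := 1 ≤ w ∧ ∀ x : H, w ⊓ |x|ₘ = 1 → x = 1

variable (H) in
/-- `H⁺` is complemented. -/
def PositiveConeComplemented : Prop :=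
  ∀ x : H, 1 ≤ x → ∃ y : H, 1 ≤ y ∧ x ⊓ y = 1 ∧ IsWeakUnit (x ⊔ y)

end Polars

end OrderedGroups

/-!
Since `η(G)` generates `F_V(G)` as a lattice, every right coset of a prime subgroup `p` of `F_V(G)`
contains some `η(a)`, so that `p` is determined by the pre-cone `{a | p ≤ p η(a)}` of `G`.
Conversely `F_V(G)` acts on the chain of any pre-cone in `P_G(V)`, and the stabilizer of the class
of `e` is the prime subgroup which belongs to it.  This bijection between `Spec F_V(G)` and
`P_G(V)` is an order isomorphism and a homeomorphism, so it maps `Min F_V(G)` onto the minimal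
layer.

In any ℓ-group `H`, taking the positive elements outside `p` identifies the minimal prime subgroups
with the maximal meet-closed sets of strictly positive elements.  Hence `w ≥ e` is a weak unit if and only if no minimal prime subgroup
contains `w`, and an element `y` as in (3) makes the sets of minimal primes avoiding `x` and `y`
complementary.  Compactness of `Min H` yields such a `y` from the cover of `Min H` by the directed
family of the sets of primes avoiding `x ∨ y`, with `x ∧ y = e`; conversely, an ultrafilter on
`Min H` converges to a minimal prime avoiding all `b` whose open set is in the ultrafilter.  In
terms of polars, (3) says that every `{x}^⊥⊥` has a principal complement `{y}^⊥⊥`.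
-/

namespace OrderedGroups

/-! ### Minimal prime subgroups and maximal meet systems -/

section PrimeSubgroups

variable {H : Type*} [Group H] [Lattice H]

theorem inf_eq_one_of_le {a b c d : H} (h : a ⊓ b = 1) (hc : 1 ≤ c) (hca : c ≤ a)
    (hd : 1 ≤ d) (hdb : d ≤ b) : c ⊓ d = 1 :=
  le_antisymm ((inf_le_inf hca hdb).trans h.le) (le_inf hc hd)

section Arithmetic

variable [MulLeftMono H]

theorem mabs_eq_one_iff {x : H} : |x|ₘ = 1 ↔ x = 1 :=
  ⟨fun h => le_antisymm (h ▸ le_mabs_self x) (inv_le_one'.1 (h ▸ inv_le_mabs x)),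
    fun h => by rw [h, mabs_one]⟩

variable [MulRightMono H]

theorem inf_mul_eq_one {a b c : H} (hb : a ⊓ b = 1) (hc : a ⊓ c = 1) : a ⊓ (b * c) = 1 := by
  have h1a : 1 ≤ a := hb.ge.trans inf_le_left
  have h1b : 1 ≤ b := hb.ge.trans inf_le_right
  have h1c : 1 ≤ c := hc.ge.trans inf_le_right
  have hle : a ⊓ (b * c) ≤ c := calc
    a ⊓ (b * c) ≤ (a * c) ⊓ (b * c) := inf_le_inf_right _ (le_mul_of_one_le_right' h1c)
    _ = c := by rw [← inf_mul, hb, one_mul]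
  exact le_antisymm ((le_inf inf_le_left hle).trans hc.le) (le_inf h1a (one_le_mul h1b h1c))

theorem inf_sup_eq_one {a b c : H} (hb : a ⊓ b = 1) (hc : a ⊓ c = 1) : a ⊓ (b ⊔ c) = 1 := by
  have h1b : 1 ≤ b := hb.ge.trans inf_le_right
  have h1c : 1 ≤ c := hc.ge.trans inf_le_right
  exact inf_eq_one_of_le (inf_mul_eq_one hb hc) (hb.ge.trans inf_le_left) le_rfl
    (le_sup_of_le_left h1b) (sup_le (le_mul_of_one_le_right' h1c) (le_mul_of_one_le_left' h1b))

theorem mabs_mul_le_mul_mul (x y : H) : |x * y|ₘ ≤ |x|ₘ * |y|ₘ * |x|ₘ := by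
  refine mabs_le'.2 ⟨?_, ?_⟩
  · exact (mul_le_mul' (le_mabs_self x) (le_mabs_self y)).trans
      (le_mul_of_one_le_right' (one_le_mabs x))
  · rw [mul_inv_rev, mul_assoc]
    exact (mul_le_mul' (inv_le_mabs y) (inv_le_mabs x)).trans
      (le_mul_of_one_le_left' (one_le_mabs x))

end Arithmetic

namespace PrimeSubgroup

section OfSubgroup

variable [MulLeftMono H] [MulRightMono H]

/-- A proper convex subgroup of an ℓ-group which contains one of `x ⊔ 1` and `x⁻¹ ⊔ 1`, for every
`x`, as a prime subgroup. -/
def ofSubgroup (S : Subgroup H) (convex : ∀ a ∈ S, ∀ b, 1 ≤ b → b ≤ a → b ∈ S) (proper : S ≠ ⊤)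
    (total : ∀ x : H, x ⊔ 1 ∈ S ∨ x⁻¹ ⊔ 1 ∈ S) : PrimeSubgroup H :=
  have sup_one_mem {x : H} (hx : x ∈ S) : x ⊔ 1 ∈ S := by
    refine (total x).elim id fun h => ?_
    simpa [mul_sup, sup_comm] using mul_mem hx h
  have sup_mem {x y : H} (hx : x ∈ S) (hy : y ∈ S) : x ⊔ y ∈ S := by
    simpa [sup_mul] using mul_mem (sup_one_mem (mul_mem hx (inv_mem hy))) hy
  { S with
    supClosed' := fun _ hx _ hy => sup_mem hx hy
    infClosed' := fun x hx y hy => by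
      simpa [inv_sup] using inv_mem (sup_mem (inv_mem hx) (inv_mem hy))
    ordConnected' := ⟨fun x hx y hy z hz => by
      have := convex _ (mul_mem hy (inv_mem hx)) (z * x⁻¹)
        (le_mul_inv_iff_mul_le.2 ((one_mul x).trans_le hz.1)) (mul_le_mul_left hz.2 _)
      simpa using mul_mem this hx⟩
    proper' := fun h => proper (SetLike.coe_injective h)
    total' := fun x y => by
      have le_sup_one_mul (u v : H) : u ≤ (u * v⁻¹ ⊔ 1) * v :=
        mul_inv_le_iff_le_mul.1 le_sup_left
      refine (total (x * y⁻¹)).imp (fun h => ⟨_, h, le_sup_one_mul x y⟩) fun h => ?_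
      rw [mul_inv_rev, inv_inv] at h
      exact ⟨_, h, le_sup_one_mul y x⟩ }

end OfSubgroup

theorem inf_mem {p : PrimeSubgroup H} {x y : H} (hx : x ∈ p) (hy : y ∈ p) : x ⊓ y ∈ p :=
  p.infClosed' hx hy

theorem mem_of_le {p : PrimeSubgroup H} {a b : H} (ha : a ∈ p) (hb : 1 ≤ b) (hba : b ≤ a) :
    b ∈ p :=
  p.ordConnected'.out (one_mem p) ha ⟨hb, hba⟩

theorem sup_mem_iff {p : PrimeSubgroup H} {a b : H} (ha : 1 ≤ a) (hb : 1 ≤ b) :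
    a ⊔ b ∈ p ↔ a ∈ p ∧ b ∈ p :=
  ⟨fun h => ⟨mem_of_le h ha le_sup_left, mem_of_le h hb le_sup_right⟩,
    fun h => p.supClosed' h.1 h.2⟩

theorem exists_notMem (p : PrimeSubgroup H) : ∃ x, x ∉ p :=
  (Set.ne_univ_iff_exists_notMem _).1 p.proper'

@[simp]
theorem mem_support_singleton {a : H} {p : PrimeSubgroup H} : p ∈ support {a} ↔ a ∉ p :=
  not_congr Set.singleton_subset_iff

theorem support_sup {a b : H} (ha : 1 ≤ a) (hb : 1 ≤ b) :
    support {a ⊔ b} = support {a} ∪ support {b} := by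
  ext p
  simp only [Set.mem_union, mem_support_singleton, sup_mem_iff ha hb, not_and_or]

theorem support_one : support {(1 : H)} = ∅ :=
  Set.eq_empty_of_forall_notMem fun p hp => mem_support_singleton.1 hp (one_mem p)

end PrimeSubgroup

/-- A meet system: a nonempty set of strictly positive elements which is closed under meets.  The
maximal ones are the positive complements of the minimal prime subgroups. -/
structure IsMeetSystem (B : Set H) : Prop where
  nonempty : B.Nonempty
  one_le : ∀ b ∈ B, 1 ≤ b
  infClosed : InfClosed B
  one_notMem : 1 ∉ B

namespace IsMeetSystem

theorem exists_le_maximal {B : Set H} (hB : IsMeetSystem B) :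
    ∃ M, B ⊆ M ∧ Maximal IsMeetSystem M := by
  refine zorn_subset_nonempty {B : Set H | IsMeetSystem B} (fun c hc hchain hne => ?_) B hB
  refine ⟨⋃₀ c, ⟨?_, ?_, ?_, ?_⟩, fun _ => Set.subset_sUnion_of_mem⟩
  · obtain ⟨C, hC⟩ := hne
    exact (hc hC).nonempty.mono (Set.subset_sUnion_of_mem hC)
  · rintro b ⟨C, hC, hb⟩
    exact (hc hC).one_le b hb
  · rintro a ⟨C, hC, ha⟩ b ⟨D, hD, hb⟩
    obtain ⟨E, hE, hCE, hDE⟩ := hchain.directedOn C hC D hD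
    exact ⟨E, hE, (hc hE).infClosed (hCE ha) (hDE hb)⟩
  · rintro ⟨C, hC, h⟩
    exact (hc hC).one_notMem h

theorem adjoin {B : Set H} (hB : IsMeetSystem B) {a : H} (ha : 1 ≤ a)
    (hne : ∀ f ∈ B, a ⊓ f ≠ 1) : IsMeetSystem {c | ∃ f ∈ B, a ⊓ f ≤ c} where
  nonempty := hB.nonempty.imp fun f hf => ⟨f, hf, inf_le_right⟩
  one_le := by
    rintro c ⟨f, hf, hc⟩
    exact (le_inf ha (hB.one_le f hf)).trans hc
  infClosed := by
    rintro c ⟨f, hf, hc⟩ d ⟨g, hg, hd⟩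
    exact ⟨f ⊓ g, hB.infClosed hf hg, le_inf ((inf_le_inf_left a inf_le_left).trans hc)
      ((inf_le_inf_left a inf_le_right).trans hd)⟩
  one_notMem := by
    rintro ⟨f, hf, h⟩
    exact hne f hf (h.antisymm (le_inf ha (hB.one_le f hf)))

theorem inf_ne_one {B : Set H} (hB : IsMeetSystem B) {a b : H} (ha : a ∈ B) (hb : b ∈ B) :
    a ⊓ b ≠ 1 :=
  fun h => hB.one_notMem (h ▸ hB.infClosed ha hb)

theorem exists_inf_eq_one_of_maximal {M : Set H} (hM : Maximal IsMeetSystem M) {a : H}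
    (ha : 1 ≤ a) (haM : a ∉ M) : ∃ f ∈ M, a ⊓ f = 1 := by
  by_contra! hne
  obtain ⟨g, hg⟩ := hM.prop.nonempty
  exact haM (hM.le_of_ge (hM.prop.adjoin ha hne) (fun f hf => ⟨f, hf, inf_le_right⟩)
    ⟨g, hg, inf_le_left⟩)

end IsMeetSystem

namespace PrimeSubgroup

/-- The set of the positive elements outside the prime subgroup `p`. -/
def posCompl (p : PrimeSubgroup H) : Set H := {a | 1 ≤ a ∧ a ∉ p}

variable [MulLeftMono H] [MulRightMono H]

theorem inf_mem_iff {p : PrimeSubgroup H} {a b : H} (ha : 1 ≤ a) (hb : 1 ≤ b) :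
    a ⊓ b ∈ p ↔ a ∈ p ∨ b ∈ p := by
  simpa only [mabs_of_one_le ha, mabs_of_one_le hb] using p.mabs_inf_mabs_mem_iff (a := a) (b := b)

theorem posCompl_subset_posCompl {p q : PrimeSubgroup H} :
    posCompl q ⊆ posCompl p ↔ p ≤ q := by
  refine ⟨fun h x hx => ?_, fun h a ha => ⟨ha.1, fun hap => ha.2 (h hap)⟩⟩
  by_contra hxq
  exact (h ⟨one_le_mabs x, mt q.mabs_mem_iff.1 hxq⟩).2 (p.mabs_mem_iff.2 hx)

theorem isMeetSystem_posCompl (p : PrimeSubgroup H) : IsMeetSystem p.posCompl where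
  nonempty := by
    obtain ⟨x, hx⟩ := p.exists_notMem
    exact ⟨|x|ₘ, one_le_mabs x, mt p.mabs_mem_iff.1 hx⟩
  one_le _ hb := hb.1
  infClosed _ ha _ hb :=
    ⟨le_inf ha.1 hb.1, fun h => ((inf_mem_iff ha.1 hb.1).1 h).elim ha.2 hb.2⟩
  one_notMem h := h.2 (one_mem p)

/-- The prime subgroup of the elements orthogonal to some member of a maximal meet system. -/
def ofMaximal {M : Set H} (hM : Maximal IsMeetSystem M) : PrimeSubgroup H :=
  ofSubgroup
    { carrier := {x | ∃ f ∈ M, f ⊓ |x|ₘ = 1}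
      mul_mem' := by
        rintro x y ⟨f, hf, hfx⟩ ⟨g, hg, hgy⟩
        have hfg := hM.prop.infClosed hf hg
        have h1 := hM.prop.one_le _ hfg
        have hx : f ⊓ g ⊓ |x|ₘ = 1 := inf_eq_one_of_le hfx h1 inf_le_left (one_le_mabs x) le_rfl
        have hy : f ⊓ g ⊓ |y|ₘ = 1 := inf_eq_one_of_le hgy h1 inf_le_right (one_le_mabs y) le_rfl
        exact ⟨f ⊓ g, hfg, inf_eq_one_of_le (inf_mul_eq_one (inf_mul_eq_one hx hy) hx) h1 le_rfl
          (one_le_mabs _) (mabs_mul_le_mul_mul x y)⟩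
      one_mem' := hM.prop.nonempty.imp fun f hf =>
        ⟨hf, by rw [mabs_one, inf_eq_right.2 (hM.prop.one_le f hf)]⟩
      inv_mem' := by
        rintro x ⟨f, hf, hfx⟩
        exact ⟨f, hf, by rwa [mabs_inv]⟩ }
    (by
      rintro a ⟨f, hf, hfa⟩ b hb hba
      exact ⟨f, hf, inf_eq_one_of_le hfa (hM.prop.one_le f hf) le_rfl (one_le_mabs b)
        ((mabs_of_one_le hb).trans_le (hba.trans (le_mabs_self a)))⟩)
    (fun htop => by
      obtain ⟨f, hf⟩ := hM.prop.nonempty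
      obtain ⟨g, hg, hgf⟩ := (htop ▸ Subgroup.mem_top f :)
      rw [mabs_of_one_le (hM.prop.one_le f hf)] at hgf
      exact hM.prop.inf_ne_one hg hf hgf)
    (fun x => by
      have mem_of_notMem {a : H} (ha : 1 ≤ a) (haM : a ∉ M) : ∃ f ∈ M, f ⊓ |a|ₘ = 1 := by
        simpa only [mabs_of_one_le ha, inf_comm a] using
          IsMeetSystem.exists_inf_eq_one_of_maximal hM ha haM
      by_cases hx : x ⊔ 1 ∈ M
      · exact .inr (mem_of_notMem le_sup_right fun hx' =>
          hM.prop.inf_ne_one hx hx' (oneLePart_inf_leOnePart_eq_one x))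
      · exact .inl (mem_of_notMem le_sup_right hx))

theorem posCompl_ofMaximal {M : Set H} (hM : Maximal IsMeetSystem M) :
    (ofMaximal hM).posCompl = M := by
  ext a
  constructor
  · rintro ⟨ha, haM⟩
    by_contra h
    obtain ⟨f, hf, haf⟩ := IsMeetSystem.exists_inf_eq_one_of_maximal hM ha h
    exact haM ⟨f, hf, by rwa [mabs_of_one_le ha, inf_comm]⟩
  · refine fun ha => ⟨hM.prop.one_le a ha, ?_⟩
    rintro ⟨f, hf, hfa⟩
    rw [mabs_of_one_le (hM.prop.one_le a ha)] at hfa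
    exact hM.prop.inf_ne_one hf ha hfa

theorem isMin_iff_maximal {p : PrimeSubgroup H} : IsMin p ↔ Maximal IsMeetSystem p.posCompl := by
  constructor
  · intro hp
    obtain ⟨M, hpM, hM⟩ := p.isMeetSystem_posCompl.exists_le_maximal
    have hle : ofMaximal hM ≤ p := by
      rwa [← posCompl_subset_posCompl, posCompl_ofMaximal]
    rwa [hle.antisymm' (hp hle), posCompl_ofMaximal]
  · intro hp q hqp
    exact posCompl_subset_posCompl.1
      (hp.le_of_ge q.isMeetSystem_posCompl (posCompl_subset_posCompl.2 hqp))

end PrimeSubgroup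

variable [MulLeftMono H] [MulRightMono H]

theorem IsMeetSystem.exists_isMin {B : Set H} (hB : IsMeetSystem B) :
    ∃ q : PrimeSubgroup H, IsMin q ∧ B ⊆ q.posCompl := by
  obtain ⟨M, hBM, hM⟩ := hB.exists_le_maximal
  refine ⟨.ofMaximal hM, PrimeSubgroup.isMin_iff_maximal.2 ?_, ?_⟩ <;>
    rwa [PrimeSubgroup.posCompl_ofMaximal]

namespace PrimeSubgroup

theorem exists_inf_eq_one_of_isMin {p : PrimeSubgroup H} (hp : IsMin p) {a : H} (ha : 1 ≤ a)
    (hap : a ∈ p) : ∃ f, 1 ≤ f ∧ f ∉ p ∧ a ⊓ f = 1 := by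
  obtain ⟨f, hf, haf⟩ := IsMeetSystem.exists_inf_eq_one_of_maximal (isMin_iff_maximal.1 hp) ha
    fun h => h.2 hap
  exact ⟨f, hf.1, hf.2, haf⟩

theorem eq_one_of_forall_isMin {x : H} (hx : ∀ p : PrimeSubgroup H, IsMin p → x ∈ p) : x = 1 := by
  by_contra hne
  have hB : IsMeetSystem {|x|ₘ} :=
    { nonempty := Set.singleton_nonempty _
      one_le := by
        rintro _ rfl
        exact one_le_mabs x
      infClosed := infClosed_singleton
      one_notMem := fun h => hne (mabs_eq_one_iff.1 h.symm) }
  obtain ⟨q, hq, hxq⟩ := hB.exists_isMin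
  exact (hxq rfl).2 (q.mabs_mem_iff.2 (hx q hq))

end PrimeSubgroup

/-! ### Compactness of the minimal spectrum -/

namespace PrimeSubgroup

open Filter Topology

theorem isOpen_support (A : Set H) : IsOpen (support A) := ⟨A, rfl⟩

theorem support_mabs (a : H) : support {|a|ₘ} = support {a} := by
  ext p
  simp only [mem_support_singleton, p.mabs_mem_iff]

theorem support_inf {a b : H} (ha : 1 ≤ a) (hb : 1 ≤ b) :
    support {a ⊓ b} = support {a} ∩ support {b} := by
  ext p
  simp only [Set.mem_inter_iff, mem_support_singleton, inf_mem_iff ha hb, not_or]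

theorem le_nhds_iff {f : Filter (PrimeSubgroup H)} {q : PrimeSubgroup H} :
    f ≤ 𝓝 q ↔ ∀ a ∉ q, support {a} ∈ f := by
  refine ⟨fun h a ha => h ((isOpen_support {a}).mem_nhds (mem_support_singleton.2 ha)),
    fun h U hU => ?_⟩
  obtain ⟨_, hAU, ⟨A, rfl⟩, hqA⟩ := mem_nhds_iff.1 hU
  obtain ⟨a, haA, haq⟩ := Set.not_subset.1 hqA
  exact mem_of_superset (h a haq) fun p hp =>
    hAU fun hAp => mem_support_singleton.1 hp (hAp haA)

theorem isWeakUnit_iff_minimalSpectrum_subset {w : H} (hw : 1 ≤ w) :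
    IsWeakUnit w ↔ minimalSpectrum H ⊆ support {w} := by
  constructor
  · intro h p hp
    refine mem_support_singleton.2 fun hwp => ?_
    obtain ⟨f, hf, hfp, hwf⟩ := exists_inf_eq_one_of_isMin hp hw hwp
    exact hfp (h.2 f (by rwa [mabs_of_one_le hf]) ▸ one_mem p)
  · refine fun h => ⟨hw, fun x hx => eq_one_of_forall_isMin fun p hp => p.mabs_mem_iff.1 ?_⟩
    have hwx : w ⊓ |x|ₘ ∈ p := hx ▸ one_mem p
    exact ((inf_mem_iff hw (one_le_mabs x)).1 hwx).resolve_left (mem_support_singleton.1 (h hp))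

theorem isMeetSystem_of_neBot (f : Filter (PrimeSubgroup H)) [f.NeBot]
    (hne : ∃ w : H, 1 ≤ w ∧ support {w} ∈ f) : IsMeetSystem {b : H | 1 ≤ b ∧ support {b} ∈ f} where
  nonempty := hne
  one_le _ hb := hb.1
  infClosed _ ha _ hb :=
    ⟨le_inf ha.1 hb.1, support_inf ha.1 hb.1 ▸ inter_mem ha.2 hb.2⟩
  one_notMem h := empty_notMem f (support_one (H := H) ▸ h.2)

theorem isCompact_minimalSpectrum_of_complemented (h : PositiveConeComplemented H) :
    IsCompact (minimalSpectrum H) := by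
  refine isCompact_iff_ultrafilter_le_nhds.2 fun f hf => ?_
  have support_mem {w : H} (hw : IsWeakUnit w) : support {w} ∈ f :=
    le_principal_iff.1 (hf.trans (principal_mono.2
      ((isWeakUnit_iff_minimalSpectrum_subset hw.1).1 hw)))
  obtain ⟨y, -, -, hy⟩ := h 1 le_rfl
  obtain ⟨q, hq, hfq⟩ := (isMeetSystem_of_neBot (f : Filter (PrimeSubgroup H))
    ⟨_, hy.1, support_mem hy⟩).exists_isMin
  refine ⟨q, hq, le_nhds_iff.2 fun a haq => ?_⟩
  obtain ⟨y, hy, hay, hw⟩ := h |a|ₘ (one_le_mabs a)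
  have hcover : support {|a|ₘ} ∪ support {y} ∈ f := support_sup (one_le_mabs a) hy ▸ support_mem hw
  rw [Ultrafilter.mem_coe, ← support_mabs]
  refine (Ultrafilter.union_mem_iff.1 hcover).resolve_right fun hyf => ?_
  exact q.isMeetSystem_posCompl.inf_ne_one ⟨one_le_mabs a, mt q.mabs_mem_iff.1 haq⟩
    (hfq ⟨hy, hyf⟩) hay

theorem complemented_of_isCompact_minimalSpectrum (h : IsCompact (minimalSpectrum H)) :
    PositiveConeComplemented H := by
  intro x hx
  let ι := {y : H // x ⊓ y = 1}
  have hι (y : ι) : 1 ≤ y.1 := y.2.ge.trans inf_le_right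
  have : Nonempty ι := ⟨1, inf_eq_right.2 hx⟩
  have hdir : Directed (· ⊆ ·) fun y : ι => support {x ⊔ y.1} := by
    intro y z
    refine ⟨⟨y.1 ⊔ z.1, inf_sup_eq_one y.2 z.2⟩, ?_, ?_⟩ <;>
      simp only [support_sup hx (hι _), support_sup (hι y) (hι z), support_sup hx
        ((hι y).trans le_sup_left)]
    · exact Set.union_subset_union_right _ Set.subset_union_left
    · exact Set.union_subset_union_right _ Set.subset_union_right
  have hcover : minimalSpectrum H ⊆ ⋃ y : ι, support {x ⊔ y.1} := by
    intro p hp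
    simp only [Set.mem_iUnion, support_sup hx (hι _), Set.mem_union, mem_support_singleton]
    by_cases hxp : x ∈ p
    · obtain ⟨f, -, hfp, hxf⟩ := exists_inf_eq_one_of_isMin hp hx hxp
      exact ⟨⟨f, hxf⟩, .inr hfp⟩
    · exact ⟨Classical.arbitrary ι, .inl hxp⟩
  obtain ⟨y, hy⟩ := h.elim_directed_cover _ (fun _ => isOpen_support _) hcover hdir
  exact ⟨y, hι y, y.2, (isWeakUnit_iff_minimalSpectrum_subset (le_sup_of_le_left hx)).2 hy⟩

theorem isCompact_minimalSpectrum_iff :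
    IsCompact (minimalSpectrum H) ↔ PositiveConeComplemented H :=
  ⟨complemented_of_isCompact_minimalSpectrum, isCompact_minimalSpectrum_of_complemented⟩

end PrimeSubgroup

end PrimeSubgroups

/-! ### Principal polars -/

section PrincipalPolars

variable {H : Type*} [Group H] [Lattice H]

theorem principalPolar_le_iff {x : H} {T : Polar H} : principalPolar x ≤ T ↔ x ∈ T.1 :=
  ⟨fun h => h (subset_perp_perp {x} rfl), fun h =>
    (perp_anti (perp_anti (Set.singleton_subset_iff.2 h))).trans T.2.subset⟩

variable [MulLeftMono H] [MulRightMono H]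

namespace Polar

theorem mabs_mem_iff {T : Polar H} {x : H} : |x|ₘ ∈ T.1 ↔ x ∈ T.1 :=
  ⟨fun h => T.mem_of_mabs_le h (mabs_mabs x).ge, fun h => T.mem_of_mabs_le h (mabs_mabs x).le⟩

theorem sup_mem_iff {T : Polar H} {x y : H} (hx : 1 ≤ x) (hy : 1 ≤ y) :
    x ⊔ y ∈ T.1 ↔ x ∈ T.1 ∧ y ∈ T.1 := by
  have mabs_sup : |x ⊔ y|ₘ = x ⊔ y := mabs_of_one_le (le_sup_of_le_left hx)
  refine ⟨fun h => ⟨T.mem_of_mabs_le h ?_, T.mem_of_mabs_le h ?_⟩, fun ⟨hxT, hyT⟩ => ?_⟩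
  · exact (mabs_of_one_le hx).trans_le (le_sup_left.trans_eq mabs_sup.symm)
  · exact (mabs_of_one_le hy).trans_le (le_sup_right.trans_eq mabs_sup.symm)
  · rw [← T.2] at hxT hyT ⊢
    intro z hz
    have hxz := hxT z hz
    have hyz := hyT z hz
    rw [mabs_of_one_le hx, inf_comm] at hxz
    rw [mabs_of_one_le hy, inf_comm] at hyz
    rw [mabs_sup, inf_comm, inf_sup_eq_one hxz hyz]

end Polar

theorem principalPolar_mabs (x : H) : principalPolar |x|ₘ = principalPolar x :=
  eq_of_forall_ge_iff fun _ => by simp only [principalPolar_le_iff, Polar.mabs_mem_iff]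

theorem principalPolar_sup {x y : H} (hx : 1 ≤ x) (hy : 1 ≤ y) :
    principalPolar (x ⊔ y) = principalPolar x ⊔ principalPolar y :=
  eq_of_forall_ge_iff fun _ => by
    simp only [sup_le_iff, principalPolar_le_iff, Polar.sup_mem_iff hx hy]

theorem principalPolar_one : principalPolar (1 : H) = ⊥ :=
  le_bot_iff.1 (principalPolar_le_iff.2 rfl)

theorem mem_compl_principalPolar_iff {x y : H} :
    x ∈ (principalPolar y)ᶜ.1 ↔ |x|ₘ ⊓ |y|ₘ = 1 := by
  change x ∈ perp (perp (perp {y})) ↔ _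
  rw [perp_perp_perp]
  exact forall_eq

theorem disjoint_principalPolar_iff {x y : H} :
    Disjoint (principalPolar x) (principalPolar y) ↔ |x|ₘ ⊓ |y|ₘ = 1 := by
  rw [← le_compl_iff_disjoint_right, principalPolar_le_iff, mem_compl_principalPolar_iff]

theorem isWeakUnit_iff_principalPolar_eq_top {w : H} (hw : 1 ≤ w) :
    IsWeakUnit w ↔ principalPolar w = ⊤ := by
  rw [← compl_eq_bot, ← le_bot_iff]
  change (1 ≤ w ∧ ∀ x, w ⊓ |x|ₘ = 1 → x = 1) ↔ ∀ x ∈ (principalPolar w)ᶜ.1, x = 1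
  simp only [mem_compl_principalPolar_iff, mabs_of_one_le hw, inf_comm w, hw, true_and]

theorem isCompl_principalPolar_iff {x y : H} (hx : 1 ≤ x) (hy : 1 ≤ y) :
    IsCompl (principalPolar x) (principalPolar y) ↔ x ⊓ y = 1 ∧ IsWeakUnit (x ⊔ y) := by
  rw [isCompl_iff, disjoint_principalPolar_iff, codisjoint_iff, mabs_of_one_le hx,
    mabs_of_one_le hy, isWeakUnit_iff_principalPolar_eq_top (le_sup_of_le_left hx),
    principalPolar_sup hx hy]

theorem positiveConeComplemented_iff_isCompl : PositiveConeComplemented H ↔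
    ∀ x : H, ∃ y : H, IsCompl (principalPolar x) (principalPolar y) := by
  constructor
  · intro h x
    obtain ⟨y, hy, hxy⟩ := h |x|ₘ (one_le_mabs x)
    exact ⟨y, principalPolar_mabs x ▸ (isCompl_principalPolar_iff (one_le_mabs x) hy).2 hxy⟩
  · intro h x hx
    obtain ⟨y, hxy⟩ := h x
    rw [← principalPolar_mabs y] at hxy
    exact ⟨|y|ₘ, one_le_mabs y, (isCompl_principalPolar_iff hx (one_le_mabs y)).1 hxy⟩

/-- `Pol_p(H)` as a Boolean subalgebra of `Pol(H)`, when every principal polar has a principal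
complement. -/
def principalPolarSubalgebra
    (h : ∀ x : H, ∃ y : H, IsCompl (principalPolar x) (principalPolar y)) :
    BooleanSubalgebra (Polar H) :=
  have supClosed : SupClosed (principalPolars H) := by
    rintro _ ⟨x, rfl⟩ _ ⟨y, rfl⟩
    rw [← principalPolar_mabs x, ← principalPolar_mabs y]
    exact ⟨_, principalPolar_sup (one_le_mabs x) (one_le_mabs y)⟩
  have compl_mem {S : Polar H} (hS : S ∈ principalPolars H) : Sᶜ ∈ principalPolars H := by
    obtain ⟨x, rfl⟩ := hS
    exact (h x).imp fun y hxy => hxy.compl_eq.symm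
  { carrier := principalPolars H
    supClosed' := supClosed
    infClosed' := fun S hS T hT => by
      simpa only [compl_sup, compl_compl] using compl_mem (supClosed (compl_mem hS) (compl_mem hT))
    compl_mem' := compl_mem
    bot_mem' := ⟨1, principalPolar_one⟩ }

theorem principalPolarsBoolean_iff : PrincipalPolarsBoolean H ↔ PositiveConeComplemented H := by
  rw [positiveConeComplemented_iff_isCompl]
  refine ⟨?_, fun h => ⟨principalPolarSubalgebra h, rfl⟩⟩
  rintro ⟨B, hB⟩ x
  have mem_B {S : Polar H} : S ∈ B ↔ S ∈ principalPolars H := Set.ext_iff.1 hB S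
  obtain ⟨y, hy⟩ := mem_B.1 (BooleanSubalgebra.compl_mem (mem_B.2 ⟨x, rfl⟩))
  exact ⟨y, hy ▸ isCompl_compl⟩

end PrincipalPolars

/-! ### Homomorphisms of ℓ-groups and lattice generation -/

section LHom

variable {H K L : Type*} [Group H] [Lattice H] [Group K] [Lattice K] [Group L] [Lattice L]

/-- Homomorphisms of ℓ-groups: group homomorphisms which preserve the lattice operations. -/
structure LHom (H K : Type*) [Group H] [Lattice H] [Group K] [Lattice K] extends
  H →* K, LatticeHom H K

namespace LHom

instance : FunLike (LHom H K) H K where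
  coe φ := φ.toFun
  coe_injective := by
    rintro ⟨⟨⟨_, _⟩, _⟩, _, _⟩ ⟨⟨⟨_, _⟩, _⟩, _, _⟩ h
    cases h
    rfl

instance : MonoidHomClass (LHom H K) H K where
  map_mul φ := φ.map_mul'
  map_one φ := φ.map_one'

instance : LatticeHomClass (LHom H K) H K where
  map_sup φ := φ.map_sup'
  map_inf φ := φ.map_inf'

/-- The composite `ψ ∘ φ` of homomorphisms of ℓ-groups. -/
def comp (ψ : LHom K L) (φ : LHom H K) : LHom H L where
  toMonoidHom := ψ.toMonoidHom.comp φ.toMonoidHom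
  map_sup' x y := (congrArg ψ (map_sup φ x y)).trans (map_sup ψ _ _)
  map_inf' x y := (congrArg ψ (map_inf φ x y)).trans (map_inf ψ _ _)

@[simp]
theorem comp_apply (ψ : LHom K L) (φ : LHom H K) (x : H) : ψ.comp φ x = ψ (φ x) := rfl

/-- The image of a homomorphism of ℓ-groups. -/
def range (φ : LHom H K) : LSubgroup K where
  toSubgroup := φ.toMonoidHom.range
  supClosed' := by
    rintro _ ⟨x, rfl⟩ _ ⟨y, rfl⟩
    exact ⟨x ⊔ y, map_sup φ x y⟩
  infClosed' := by
    rintro _ ⟨x, rfl⟩ _ ⟨y, rfl⟩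
    exact ⟨x ⊓ y, map_inf φ x y⟩

theorem map_eval {X : Type*} (φ : LHom H K) (f : X → H) (t : LTerm X) :
    φ (t.eval f) = t.eval (φ ∘ f) := by
  induction t with
  | var => rfl
  | one => exact map_one φ
  | mul s t hs ht => simp only [LTerm.eval, map_mul, hs, ht]
  | inv s hs => simp only [LTerm.eval, map_inv, hs]
  | sup s t hs ht => simp only [LTerm.eval, map_sup, hs, ht]
  | inf s t hs ht => simp only [LTerm.eval, map_inf, hs, ht]

end LHom

namespace LSubgroup

/-- The inclusion of an ℓ-subgroup. -/
def subtype (M : LSubgroup K) : LHom M K where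
  toMonoidHom := SubgroupClass.subtype M
  map_sup' _ _ := rfl
  map_inf' _ _ := rfl

theorem subtype_injective (M : LSubgroup K) : Function.Injective M.subtype :=
  Subtype.val_injective

theorem subset_closure (S : Set K) : S ⊆ closure S := fun _ hx _ hS => hS hx

theorem closure_subset {S : Set K} {M : LSubgroup K} (h : S ⊆ M) : (closure S : Set K) ⊆ M :=
  fun _ hx => hx M h

instance (M : LSubgroup K) [MulLeftMono K] : MulLeftMono M :=
  ⟨fun a _ _ h => mul_le_mul_right (α := K) h a.1⟩

instance (M : LSubgroup K) [MulRightMono K] : MulRightMono M :=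
  ⟨fun a _ _ h => mul_le_mul_left (α := K) h a.1⟩

/-- The sublattice generated by a subgroup, which is again a subgroup. -/
def latticeClosure [MulLeftMono K] [MulRightMono K] (S : Subgroup K) : LSubgroup K :=
  have isSublattice : IsSublattice (_root_.latticeClosure (S : Set K)) :=
    isSublattice_latticeClosure
  { carrier := _root_.latticeClosure S
    one_mem' := subset_latticeClosure (one_mem S)
    mul_mem' := by
      intro x y hx hy
      induction hx using latticeClosure_sup_inf_induction with
      | mem s hs =>
        induction hy using latticeClosure_sup_inf_induction with
        | mem t ht => exact subset_latticeClosure (mul_mem hs ht)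
        | sup y _ z _ ihy ihz => exact mul_sup y z s ▸ isSublattice.supClosed ihy ihz
        | inf y _ z _ ihy ihz => exact mul_inf y z s ▸ isSublattice.infClosed ihy ihz
      | sup x _ z _ ihx ihz => exact sup_mul x z y ▸ isSublattice.supClosed ihx ihz
      | inf x _ z _ ihx ihz => exact inf_mul x z y ▸ isSublattice.infClosed ihx ihz
    inv_mem' := by
      intro x hx
      induction hx using latticeClosure_sup_inf_induction with
      | mem s hs => exact subset_latticeClosure (inv_mem hs)
      | sup x _ y _ ihx ihy => exact inv_sup x y ▸ isSublattice.infClosed ihx ihy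
      | inf x _ y _ ihx ihy => exact inv_inf x y ▸ isSublattice.supClosed ihx ihy
    supClosed' := isSublattice.supClosed
    infClosed' := isSublattice.infClosed }

end LSubgroup

theorem LVariety.Mem.of_subset_range {V : LVariety} (hV : V.Mem H) (φ : LHom H K)
    {M : LSubgroup K} (hM : (M : Set K) ⊆ φ.range) : V.Mem M := by
  intro e he f
  choose g hg using fun n => hM (f n).2
  apply M.subtype_injective
  have hfg : M.subtype ∘ f = φ ∘ g := funext fun n => (hg n).symm
  rw [LHom.map_eval, LHom.map_eval, hfg, ← LHom.map_eval, ← LHom.map_eval, hV e he g]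

theorem FreeLGroup.mem_latticeClosure_range_eta {V : LVariety} {G : Type*} [Group G]
    [PartialOrder G] (x : FreeLGroup V G) :
    x ∈ latticeClosure (Set.range (eta : G →* FreeLGroup V G)) := by
  let E : LSubgroup (FreeLGroup V G) := LSubgroup.latticeClosure eta.range
  obtain ⟨t, rfl⟩ := mk_surjective x
  change mk t ∈ E
  induction t with
  | var a => exact subset_latticeClosure ⟨a, rfl⟩
  | one => exact one_mem E
  | mul s t hs ht => exact mul_mem hs ht
  | inv s hs => exact inv_mem hs
  | sup s t hs ht => exact E.supClosed' hs ht
  | inf s t hs ht => exact E.infClosed' hs ht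

end LHom

/-! ### Chains of cosets and stabilizers -/

namespace ChainAut

variable {Ω Ω' : Type*} [LinearOrder Ω] [LinearOrder Ω']

theorem mul_apply (f g : ChainAut Ω) (ω : Ω) : (f * g) ω = g (f ω) := rfl

theorem one_apply (ω : Ω) : (1 : ChainAut Ω) ω = ω := rfl

theorem sup_apply (f g : ChainAut Ω) (ω : Ω) : (f ⊔ g) ω = f ω ⊔ g ω := rfl

theorem inf_apply (f g : ChainAut Ω) (ω : Ω) : (f ⊓ g) ω = f ω ⊓ g ω := rfl

theorem inv_apply_le_iff {f : ChainAut Ω} {ω ω' : Ω} : f⁻¹ ω ≤ ω' ↔ ω ≤ f ω' :=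
  OrderIso.symm_apply_le f

theorem inv_apply_eq_iff {f : ChainAut Ω} {ω ω' : Ω} : f⁻¹ ω = ω' ↔ ω = f ω' :=
  OrderIso.symm_apply_eq f

/-- Transport of order automorphisms along an isomorphism of chains. -/
def conj (e : Ω ≃o Ω') : LHom (ChainAut Ω') (ChainAut Ω) where
  toFun f := (e.trans f).trans e.symm
  map_one' := DFunLike.ext _ _ e.symm_apply_apply
  map_mul' f g := DFunLike.ext _ _ fun ω =>
    congrArg (fun ω' => e.symm (g ω')) (e.apply_symm_apply (f (e ω))).symm
  map_sup' f g := DFunLike.ext _ _ fun ω => e.symm.map_sup (f (e ω)) (g (e ω))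
  map_inf' f g := DFunLike.ext _ _ fun ω => e.symm.map_inf (f (e ω)) (g (e ω))

theorem conj_apply (e : Ω ≃o Ω') (f : ChainAut Ω') (ω : Ω) : conj e f ω = e.symm (f (e ω)) := rfl

end ChainAut

namespace PreCone

variable {G : Type*} [Group G] [PartialOrder G] {C : PreCone G}

theorem cls_surjective : Function.Surjective C.cls := Quotient.exists_rep

theorem cls_one_le_cls {a : G} : C.cls 1 ≤ C.cls a ↔ a ∈ C := by
  rw [C.cls_le_cls, Le, inv_one, mul_one]

theorem exists_notMem (C : PreCone G) : ∃ a, a ∉ C :=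
  (Set.ne_univ_iff_exists_notMem _).1 C.proper'

end PreCone

namespace PrimeSubgroup

open TopologicalSpace

variable {H : Type*} [Group H] [Lattice H]

theorem inf_one_mem_of_le {p : PrimeSubgroup H} {x y : H} (hx : x ⊓ 1 ∈ p) (hxy : x ≤ y) :
    y ⊓ 1 ∈ p :=
  p.ordConnected'.out hx (one_mem p) ⟨inf_le_inf_right 1 hxy, inf_le_right⟩

variable [MulLeftMono H] [MulRightMono H]

theorem sup_one_mem_iff {p : PrimeSubgroup H} {x : H} : x ⊔ 1 ∈ p ↔ x⁻¹ ⊓ 1 ∈ p := by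
  rw [← inv_mem_iff, inv_sup, inv_one]

/-- The pre-cone `{x | x ⊓ 1 ∈ p}` of a prime subgroup `p`.  Its chain is the chain of right cosets
of `p`, as `x ⊓ 1 ∈ p` if and only if `p ≤ p x`. -/
def cone (p : PrimeSubgroup H) : PreCone H where
  carrier := {x | x ⊓ 1 ∈ p}
  one_mem' := by simp
  mul_mem' {x y} hx hy := by
    have hle : (x ⊓ 1) * (y ⊓ 1) ≤ x * y := mul_le_mul' inf_le_left inf_le_left
    exact p.ordConnected'.out (p.mul_mem' hx hy) (one_mem p)
      ⟨le_inf hle (mul_le_one' inf_le_right inf_le_right), inf_le_right⟩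
  total' x := by
    have h : (x ⊔ 1) ⊓ (x⁻¹ ⊔ 1) ∈ p :=
      (oneLePart_inf_leOnePart_eq_one x).symm.subst (motive := (· ∈ p)) (one_mem p)
    rw [inf_mem_iff le_sup_right le_sup_right, sup_one_mem_iff, sup_one_mem_iff, inv_inv] at h
    exact h.symm
  pos' a ha := by
    rw [Set.mem_ofPred_eq, inf_eq_right.2 ha]
    exact one_mem p
  proper' h := by
    obtain ⟨x, hx⟩ := p.exists_notMem
    have hx₁ : x ⊓ 1 ∈ p := h.ge (Set.mem_univ x)
    have hx₂ : x⁻¹ ⊓ 1 ∈ p := h.ge (Set.mem_univ x⁻¹)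
    exact hx (p.ordConnected'.out hx₁ (sup_one_mem_iff.2 hx₂) ⟨inf_le_left, le_sup_left⟩)

section Cone

variable {p q : PrimeSubgroup H} {x y : H}

theorem mem_cone_iff : x ∈ p.cone ↔ x ⊓ 1 ∈ p := Iff.rfl

theorem inv_mem_cone_iff : x⁻¹ ∈ p.cone ↔ x ⊔ 1 ∈ p := sup_one_mem_iff.symm

theorem mem_iff_mem_cone : x ∈ p ↔ x ∈ p.cone ∧ x⁻¹ ∈ p.cone := by
  rw [inv_mem_cone_iff, mem_cone_iff]
  exact ⟨fun h => ⟨inf_mem h (one_mem p), p.supClosed' h (one_mem p)⟩,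
    fun h => p.ordConnected'.out h.1 h.2 ⟨inf_le_left, le_sup_left⟩⟩

theorem inf_mem_cone_iff : x ⊓ y ∈ p.cone ↔ x ∈ p.cone ∧ y ∈ p.cone := by
  simp only [mem_cone_iff]
  refine ⟨fun h => ⟨inf_one_mem_of_le h inf_le_left, inf_one_mem_of_le h inf_le_right⟩,
    fun h => ?_⟩
  rw [inf_inf_distrib_right]
  exact inf_mem h.1 h.2

theorem cls_sup (x y : H) : p.cone.cls (x ⊔ y) = p.cone.cls x ⊔ p.cone.cls y := by
  refine eq_of_forall_ge_iff fun ω => ?_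
  obtain ⟨z, rfl⟩ := PreCone.cls_surjective ω
  simp only [sup_le_iff, PreCone.cls_le_cls, PreCone.Le, inv_sup, mul_inf, inf_mem_cone_iff]

theorem cls_inf (x y : H) : p.cone.cls (x ⊓ y) = p.cone.cls x ⊓ p.cone.cls y := by
  refine eq_of_forall_le_iff fun ω => ?_
  obtain ⟨z, rfl⟩ := PreCone.cls_surjective ω
  simp only [le_inf_iff, PreCone.cls_le_cls, PreCone.Le, inf_mul, inf_mem_cone_iff]

theorem sup_mem_cone_iff : x ⊔ y ∈ p.cone ↔ x ∈ p.cone ∨ y ∈ p.cone := by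
  simp only [← PreCone.cls_one_le_cls, cls_sup, le_sup_iff]

variable (p) in
/-- The action of `H` on the chain of right cosets of `p`. -/
noncomputable def cosetAction : LHom H (ChainAut p.cone.Omega) where
  toMonoidHom := p.cone.rho
  map_sup' x y := by
    refine DFunLike.ext _ _ fun ω => ?_
    obtain ⟨z, rfl⟩ := PreCone.cls_surjective ω
    exact (congrArg p.cone.cls (mul_sup x y z)).trans (cls_sup _ _)
  map_inf' x y := by
    refine DFunLike.ext _ _ fun ω => ?_
    obtain ⟨z, rfl⟩ := PreCone.cls_surjective ω
    exact (congrArg p.cone.cls (mul_inf x y z)).trans (cls_inf _ _)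

end Cone

theorem support_sup_one (x : H) : support {x ⊔ 1} = {p | x⁻¹ ∉ p.cone} := by
  ext p
  rw [mem_support_singleton, ← inv_mem_cone_iff, Set.mem_ofPred_eq]

theorem support_eq_biUnion (A : Set H) :
    support A = ⋃ a ∈ A, support {a ⊔ 1} ∪ support {a⁻¹ ⊔ 1} := by
  ext p
  simp only [support_sup_one, Set.mem_iUnion, Set.mem_union, Set.mem_ofPred_eq, inv_inv,
    exists_prop, ← not_and_or, and_comm (a := _⁻¹ ∈ p.cone), ← mem_iff_mem_cone]
  exact Set.not_subset

theorem support_inf_sup_one (x y : H) :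
    support {x ⊓ y ⊔ 1} = support {x ⊔ 1} ∩ support {y ⊔ 1} := by
  ext p
  simp only [support_sup_one, Set.mem_inter_iff, Set.mem_ofPred_eq, inv_inf, sup_mem_cone_iff,
    not_or]

section Generation

variable {S : Set H} (hS : ∀ x, x ∈ latticeClosure S)

include hS

theorem exists_cls_eq {p : PrimeSubgroup H} (ω : p.cone.Omega) : ∃ s ∈ S, p.cone.cls s = ω := by
  obtain ⟨x, rfl⟩ := PreCone.cls_surjective ω
  induction hS x using latticeClosure_sup_inf_induction with
  | mem s hs => exact ⟨s, hs, rfl⟩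
  | sup x _ y _ ihx ihy =>
    rw [cls_sup]
    rcases max_choice (p.cone.cls x) (p.cone.cls y) with h | h <;> rwa [h]
  | inf x _ y _ ihx ihy =>
    rw [cls_inf]
    rcases min_choice (p.cone.cls x) (p.cone.cls y) with h | h <;> rwa [h]

theorem exists_notMem_cone (p : PrimeSubgroup H) : ∃ s ∈ S, s ∉ p.cone := by
  obtain ⟨x, hx⟩ := p.cone.exists_notMem
  obtain ⟨s, hs, hsx⟩ := exists_cls_eq hS (p.cone.cls x)
  exact ⟨s, hs, fun h => hx (PreCone.cls_one_le_cls.1 (hsx ▸ PreCone.cls_one_le_cls.2 h))⟩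

theorem le_iff_forall_mem_cone {p q : PrimeSubgroup H} :
    p ≤ q ↔ ∀ s ∈ S, s ∈ p.cone → s ∈ q.cone := by
  refine ⟨fun h s _ hs => h hs, fun h => ?_⟩
  have hcone (x : H) : x ∈ p.cone → x ∈ q.cone := by
    induction hS x using latticeClosure_sup_inf_induction with
    | mem s hs => exact h s hs
    | sup x _ y _ ihx ihy =>
      simp only [sup_mem_cone_iff]
      exact Or.imp ihx ihy
    | inf x _ y _ ihx ihy =>
      simp only [inf_mem_cone_iff]
      exact And.imp ihx ihy
  exact fun x hx => mem_iff_mem_cone.2 ((mem_iff_mem_cone.1 hx).imp (hcone x) (hcone x⁻¹))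

theorem topology_eq_generateFrom :
    (inferInstance : TopologicalSpace (PrimeSubgroup H)) =
      generateFrom ((fun s => {p : PrimeSubgroup H | s⁻¹ ∉ p.cone}) '' S) := by
  simp only [← support_sup_one]
  refine le_antisymm (le_generateFrom ?_) ?_
  · rintro _ ⟨s, -, rfl⟩
    exact isOpen_support _
  · rintro _ ⟨A, rfl⟩
    let _ : TopologicalSpace (PrimeSubgroup H) := generateFrom ((fun s => support {s ⊔ 1}) '' S)
    have hopen (x : H) : IsOpen (support {x ⊔ 1}) := by
      induction hS x using latticeClosure_sup_inf_induction with
      | mem s hs => exact isOpen_generateFrom_of_mem ⟨s, hs, rfl⟩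
      | sup x _ y _ ihx ihy =>
        rw [sup_sup_distrib_right, support_sup le_sup_right le_sup_right]
        exact ihx.union ihy
      | inf x _ y _ ihx ihy =>
        rw [support_inf_sup_one]
        exact ihx.inter ihy
    rw [support_eq_biUnion]
    exact isOpen_biUnion fun a _ => (hopen a).union (hopen a⁻¹)

end Generation

/-- The stabilizer of a point under an action of an ℓ-group on a chain. -/
def stabilizer {Ω : Type*} [LinearOrder Ω] (φ : LHom H (ChainAut Ω)) (ω : Ω)
    (hω : ∃ x, φ x ω ≠ ω) : PrimeSubgroup H :=
  ofSubgroup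
    { carrier := {x | φ x ω = ω}
      one_mem' := by rw [Set.mem_ofPred_eq, map_one, ChainAut.one_apply]
      mul_mem' {x y} hx hy := by
        rw [Set.mem_ofPred_eq, map_mul, ChainAut.mul_apply, hx, hy]
      inv_mem' {x} hx := by
        rw [Set.mem_ofPred_eq, map_inv, ChainAut.inv_apply_eq_iff, hx] }
    (fun a ha b hb hba => by
      have hb' : ω ≤ φ b ω := (congrArg (· ω) (map_one φ)).ge.trans (OrderHomClass.mono φ hb ω)
      exact ((OrderHomClass.mono φ hba ω).trans_eq ha).antisymm hb')
    (fun h => by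
      obtain ⟨x, hx⟩ := hω
      exact hx (h ▸ Subgroup.mem_top x :))
    (fun x => by
      have mem_iff (y : H) : φ (y ⊔ 1) ω = ω ↔ φ y ω ≤ ω := by
        rw [map_sup, map_one, ChainAut.sup_apply, ChainAut.one_apply, sup_eq_right]
      refine (le_total (φ x ω) ω).imp (mem_iff x).2 fun h => (mem_iff x⁻¹).2 ?_
      rwa [map_inv, ChainAut.inv_apply_le_iff])

theorem mem_cone_stabilizer {Ω : Type*} [LinearOrder Ω] {φ : LHom H (ChainAut Ω)} {ω : Ω}
    {hω : ∃ x, φ x ω ≠ ω} {x : H} : x ∈ (stabilizer φ ω hω).cone ↔ ω ≤ φ x ω := by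
  change φ (x ⊓ 1) ω = ω ↔ _
  rw [map_inf, map_one, ChainAut.inf_apply, ChainAut.one_apply, inf_eq_right]

end PrimeSubgroup

/-! ### Prime subgroups and pre-cones -/

namespace PreCone

variable {G H : Type*} [Group G] [PartialOrder G] [Group H] [PartialOrder H]

theorem rho_monotone [MulLeftMono G] [MulRightMono G] (C : PreCone G) : Monotone C.rho := by
  intro a b hab ω
  obtain ⟨c, rfl⟩ := C.cls_surjective ω
  change C.cls (c * a) ≤ C.cls (c * b)
  rw [cls_le_cls]
  refine C.pos' _ ?_
  rw [le_mul_inv_iff_mul_le, one_mul]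
  exact mul_le_mul_right hab c

/-- The preimage of a pre-cone under an order-preserving homomorphism, if it is proper. -/
def comap (C : PreCone H) (η : G →* H) (hη : Monotone η) (hC : ∃ a, η a ∉ C) : PreCone G where
  toSubmonoid := C.toSubmonoid.comap η
  total' a := by
    change η a ∈ C ∨ η a⁻¹ ∈ C
    rw [map_inv]
    exact C.total' (η a)
  pos' a ha := C.pos' _ ((map_one η).ge.trans (hη ha))
  proper' h := by
    obtain ⟨a, ha⟩ := hC
    exact ha (h.ge (Set.mem_univ a))

section Comap

variable {C : PreCone H} {η : G →* H} {hη : Monotone η} {hC : ∃ a, η a ∉ C}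

theorem mem_comap {a : G} : a ∈ C.comap η hη hC ↔ η a ∈ C := Iff.rfl

theorem le_comap_iff {a b : G} : (C.comap η hη hC).Le a b ↔ C.Le (η a) (η b) := by
  rw [Le, mem_comap, map_mul, map_inv, Le]

variable (C η hη hC) in
/-- The embedding `[a] ↦ [η a]` of the chain of the preimage of `C` under `η`. -/
noncomputable def omegaEmbedding : (C.comap η hη hC).Omega ↪o C.Omega :=
  OrderEmbedding.ofMapLEIff
    (Quotient.map (sa := (C.comap η hη hC).setoid) (sb := C.setoid) η
      fun _ _ h => ⟨le_comap_iff.1 h.1, le_comap_iff.1 h.2⟩)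
    (by
      rintro ⟨a⟩ ⟨b⟩
      exact le_comap_iff.symm)

end Comap

end PreCone

theorem LVariety.Mem.comap_cone {V : LVariety} {G H : Type*} [Group G] [PartialOrder G] [Group H]
    [Lattice H] [MulLeftMono H] [MulRightMono H] (hV : V.Mem H) {η : G →* H} {hη : Monotone η}
    (hgen : ∀ x, x ∈ latticeClosure (Set.range η)) (p : PrimeSubgroup H)
    {hp : ∃ a, η a ∉ p.cone} : V.Mem (p.cone.comap η hη hp).H := by
  have hsurj : Function.Surjective (p.cone.omegaEmbedding η hη hp) := fun ω => by
    obtain ⟨_, ⟨a, rfl⟩, ha⟩ := PrimeSubgroup.exists_cls_eq hgen ω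
    exact ⟨PreCone.cls _ a, ha⟩
  let e := RelIso.ofSurjective (p.cone.omegaEmbedding η hη hp) hsurj
  have he (a : G) : (ChainAut.conj e).comp p.cosetAction (η a) = (p.cone.comap η hη hp).rho a := by
    refine DFunLike.ext _ _ fun ω => ?_
    obtain ⟨b, rfl⟩ := PreCone.cls_surjective ω
    rw [LHom.comp_apply, ChainAut.conj_apply, OrderIso.symm_apply_eq, PreCone.rho_apply]
    exact congrArg p.cone.cls (map_mul η b a).symm
  refine hV.of_subset_range ((ChainAut.conj e).comp p.cosetAction) (LSubgroup.closure_subset ?_)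
  rintro _ ⟨a, rfl⟩
  exact ⟨η a, he a⟩

section Correspondence

variable {V : LVariety} {G : Type*} [Group G] [PartialOrder G]

namespace VPreorders

theorem exists_lHom [MulLeftMono G] [MulRightMono G] (C : VPreorders V G) :
    ∃ φ : LHom (FreeLGroup V G) (ChainAut C.1.Omega),
      ∀ a, φ (FreeLGroup.eta a) = C.1.rho a := by
  let ρ : G →* C.1.H := C.1.rho.codRestrict C.1.H fun a => LSubgroup.subset_closure _ ⟨a, rfl⟩
  obtain ⟨φ, ⟨hsup, hinf, hφ⟩, -⟩ := FreeLGroup.existsUnique_lift C.2 ρ C.1.rho_monotone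
  refine ⟨C.1.H.subtype.comp { φ with map_sup' := hsup, map_inf' := hinf }, fun a => ?_⟩
  exact congrArg Subtype.val (hφ a)

end VPreorders

namespace PrimeSubgroup

open Topology TopologicalSpace

theorem exists_eta_notMem_cone (p : PrimeSubgroup (FreeLGroup V G)) :
    ∃ a, FreeLGroup.eta a ∉ p.cone := by
  simpa only [Set.exists_range_iff] using
    p.exists_notMem_cone FreeLGroup.mem_latticeClosure_range_eta

/-- The right pre-order `a ≼ b ↔ p η(a) ≤ p η(b)` of a prime subgroup `p` of `F_V(G)`. -/
def toVPreorder (p : PrimeSubgroup (FreeLGroup V G)) : VPreorders V G :=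
  ⟨p.cone.comap FreeLGroup.eta FreeLGroup.eta_monotone p.exists_eta_notMem_cone,
    (FreeLGroup.mem_variety V G).comap_cone FreeLGroup.mem_latticeClosure_range_eta p⟩

theorem mem_toVPreorder {p : PrimeSubgroup (FreeLGroup V G)} {a : G} :
    a ∈ p.toVPreorder.1 ↔ FreeLGroup.eta a ∈ p.cone := Iff.rfl

theorem toVPreorder_le_iff {p q : PrimeSubgroup (FreeLGroup V G)} :
    p.toVPreorder ≤ q.toVPreorder ↔ p ≤ q := by
  rw [le_iff_forall_mem_cone FreeLGroup.mem_latticeClosure_range_eta, Set.forall_mem_range]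
  rfl

theorem toVPreorder_surjective [MulLeftMono G] [MulRightMono G] :
    Function.Surjective (toVPreorder : PrimeSubgroup (FreeLGroup V G) → VPreorders V G) := by
  intro C
  obtain ⟨φ, hφ⟩ := C.exists_lHom
  have le_iff (a : G) : C.1.cls 1 ≤ φ (FreeLGroup.eta a) (C.1.cls 1) ↔ a ∈ C.1 := by
    rw [hφ, PreCone.rho_apply, one_mul, PreCone.cls_one_le_cls]
  have hmoves : ∃ x, φ x (C.1.cls 1) ≠ C.1.cls 1 := by
    obtain ⟨a, ha⟩ := C.1.exists_notMem
    exact ⟨FreeLGroup.eta a, fun h => ha ((le_iff a).1 h.ge)⟩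
  refine ⟨stabilizer φ (C.1.cls 1) hmoves, Subtype.ext (SetLike.ext fun a => ?_)⟩
  rw [mem_toVPreorder, mem_cone_stabilizer, le_iff]

/-- The order isomorphism between the prime subgroups of `F_V(G)` and the right pre-orders of `V`
on `G`. -/
noncomputable def orderIsoVPreorders [MulLeftMono G] [MulRightMono G] :
    PrimeSubgroup (FreeLGroup V G) ≃o VPreorders V G :=
  RelIso.ofSurjective (OrderEmbedding.ofMapLEIff toVPreorder fun _ _ => toVPreorder_le_iff)
    toVPreorder_surjective

theorem preimage_basicOpen (a : G) :
    toVPreorder ⁻¹' VPreorders.basicOpen (V := V) a = {p | (FreeLGroup.eta a)⁻¹ ∉ p.cone} := by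
  ext p
  rw [Set.mem_ofPred_eq, ← map_inv]
  exact and_iff_right_of_imp (p.toVPreorder.1.total' a).resolve_right

theorem isInducing_toVPreorder :
    IsInducing (toVPreorder : PrimeSubgroup (FreeLGroup V G) → VPreorders V G) := by
  refine ⟨(topology_eq_generateFrom FreeLGroup.mem_latticeClosure_range_eta).trans ?_⟩
  refine Eq.trans ?_ induced_generateFrom_eq.symm
  rw [← Set.range_comp, ← Set.range_comp]
  exact congrArg (fun f => generateFrom (Set.range f)) (funext fun a => (preimage_basicOpen a).symm)

theorem image_minimalSpectrum [MulLeftMono G] [MulRightMono G] :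
    toVPreorder '' minimalSpectrum (FreeLGroup V G) = VPreorders.minimalLayer V G := by
  refine Set.ext fun C => ⟨?_, fun hC => ?_⟩
  · rintro ⟨p, hp, rfl⟩
    exact (orderIsoVPreorders.isMin_apply (x := p)).2 hp
  · obtain ⟨p, rfl⟩ := toVPreorder_surjective C
    exact ⟨p, (orderIsoVPreorders.isMin_apply (x := p)).1 hC, rfl⟩

theorem isCompact_minimalLayer_iff [MulLeftMono G] [MulRightMono G] :
    IsCompact (VPreorders.minimalLayer V G) ↔ IsCompact (minimalSpectrum (FreeLGroup V G)) := by
  rw [isInducing_toVPreorder.isCompact_iff, image_minimalSpectrum]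

end PrimeSubgroup

end Correspondence

end OrderedGroups

theorem corollary6p6 (G : Type*) [Group G] [PartialOrder G] [MulLeftMono G] [MulRightMono G]
    (V : OrderedGroups.LVariety) :
    (IsCompact (OrderedGroups.VPreorders.minimalLayer V G) ↔
      OrderedGroups.PrincipalPolarsBoolean (OrderedGroups.FreeLGroup V G)) ∧
    (IsCompact (OrderedGroups.VPreorders.minimalLayer V G) ↔
      IsCompact (OrderedGroups.minimalSpectrum (OrderedGroups.FreeLGroup V G))) ∧
    (IsCompact (OrderedGroups.VPreorders.minimalLayer V G) ↔
      OrderedGroups.PositiveConeComplemented (OrderedGroups.FreeLGroup V G)) := by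
  rw [OrderedGroups.PrimeSubgroup.isCompact_minimalLayer_iff,
    OrderedGroups.principalPolarsBoolean_iff,
    OrderedGroups.PrimeSubgroup.isCompact_minimalSpectrum_iff]
  exact ⟨Iff.rfl, Iff.rfl, Iff.rfl⟩
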